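/- **Setting.** Let $d\ge 2$, $T\in\mathbb N$, let $\mathcal X\subset\mathbb R^d$ be closed, star-convex about the origin, with $\|x\|\le 1$ for all $x\in\mathcal X$, and let $\theta,a\in\mathbb R^d$ with $\|\theta\|\le S_\theta$, $\|a\|\le S_a$, where $S_\theta,S_a>0$; put $S=\max(S_a,S_\theta)$. Let $b>0$ with $b/S_a\le 1$, $\mathcal Y=\{x\in\mathcal X: a^\top x\le b\}$, let $x_*\in\arg\max_{x\in\mathcal Y}\theta^\top x$ and assume $\theta^\top x_*>0$. The reward gap is $$\Delta=\inf\{\theta^\top(x_*-x): x\in\mathcal Y,\ x\ne\alpha x_*\ \forall\alpha>0\}.$$ In round $t=1,\dots,T$ a learner plays $x_t\in\mathcal X$ and observes $y_t=\theta^\top x_t+\epsilon_t$ and $z_t=a^\top x_t+\eta_t$. The noise is $\rho$-subgaussian, $\rho\ge 0$: $\mathbb E[\epsilon_t\mid x_1,\epsilon_1,\dots,\epsilon_{t-1},x_t]=0$ and $\mathbb E[e^{s\epsilon_t}\mid x_1,\epsilon_1,\dots,\epsilon_{t-1},x_t]\le e^{s^2\rho^2/2}$ for all $s\in\mathbb R$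 and $t\le T$, and likewise with $\eta$ in place of $\epsilon$. Let $\lambda\ge1$, $\delta\in(0,1)$, and $$\beta_t=\rho\sqrt{d\log\frac{1+(t-1)/\lambda}{\delta/2}}+\sqrt\lambda\,S ,$$ with $\tilde\beta_t$ the same quantity with $d=1$ (the index $t$ may be any real number). Let $V_t=\lambda I+\sum_{k<t}x_kx_k^\top$, $\hat\theta_t=V_t^{-1}\sum_{k<t}x_ky_k$, $\hat a_t=V_t^{-1}\sum_{k<t}x_kz_k$, $\|x\|_{M}=\sqrt{x^\top Mx}$, and $\mathcal Y_t^p=\{x\in\mathcal X:\hat a_t^\top x+\beta_t\|x\|_{V_t^{-1}}\le b\}$. *OPLB* plays $$x_t\in\arg\max_{x\in\mathcal Y^p_t}\big(\hat\theta_t^\top x+\kappa\beta_t\|x\|_{V_t^{-1}}\big),\qquad \kappa=1+\frac{2S_\theta}{b}.$$ Put $$\bar B=\frac{8d\,(1+2S/b)^2\beta_T^2}{\Delta^2}\log\Big(1+\frac{T}{\lambda d}\Big).$$ *PD-OPLB* plays OPLB until, after some round $n$, a single direction (unit vector) $u_*$ has been played more than $\bar B$ times, i.e. more than $\bar B$ of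 the actions $x_1,\dots,x_n$ are positive multiples of $u_*$. In each later round $t>n$ it plays $x_t=\xi_tu_*$, where $\xi_t$ is the largest $\xi\in\mathbb R$ with $\xi u_*\in\mathcal X$ and $\hat\phi_t\xi+\tilde\beta_{t-n}|\xi|/\sqrt{v_t}\le b$; here $v_t=\lambda+\sum_{n<s<t}\xi_s^2$ and $\hat\phi_t=v_t^{-1}\sum_{n<s<t}\xi_sz_s$. **Theorem.** Suppose $\Delta>0$. 1. If OPLB is played, then with probability at least $1-\delta$ the number $B_T$ of rounds $t\le T$ in which $x_t$ is not a positive multiple of $x_*$ satisfies $$B_T\le \frac{8d\,(1+2S/b)^2\beta_T^2}{\Delta^2}\log\Big(1+\frac{T}{\lambda d}\Big).$$ 2. If PD-OPLB is played, then with probability at least $1-2\delta$ the regret $R_T=\sum_{t=1}^T\theta^\top(x_*-x_t)$ satisfies both $$R_T\le 4\Big(1+\frac Sb\Big)\beta_{2\bar B}\sqrt{d\bar B\log\Big(1+\frac{2\bar B}{\lambda d}\Big)}+2\Big(1+\frac Sb\Big)\tilde\beta_T\sqrt{2T\log\Big(1+\frac{T}{\lambda d}\Big)}$$ and $$R_T\le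 C\Big(\frac{d^2}{\Delta}+\sqrt T\Big)\log(2+T)^k ,$$ where $C$ and $k$ depend only on $b,S_a,S_\theta,\rho,\lambda,\delta$. In particular $R_T=\tilde{\mathcal O}(d^2/\Delta+\sqrt T)$. -/

import Mathlib

open MeasureTheory
open scoped Matrix

noncomputable section

namespace SafeBandit

/-- The space of actions and parameters, with the Euclidean norm. -/
abbrev Vec (d : ℕ) : Type := EuclideanSpace ℝ (Fin d)

/-- The quantities known to the learner: the constraint limit, the norm bounds on the constraint
and reward vectors, the subgaussian constant of the noise, the regularization parameter and the
confidence parameter. -/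
structure Params where
  b : ℝ
  Sa : ℝ
  Sθ : ℝ
  ρ : ℝ
  lam : ℝ
  δ : ℝ

structure Params.Valid (P : Params) : Prop where
  b_pos : 0 < P.b
  Sa_pos : 0 < P.Sa
  Sθ_pos : 0 < P.Sθ
  b_le : P.b / P.Sa ≤ 1
  ρ_nonneg : 0 ≤ P.ρ
  lam_ge : 1 ≤ P.lam
  δ_pos : 0 < P.δ
  δ_lt : P.δ < 1

def Params.S (P : Params) : ℝ := max P.Sa P.Sθ

/-- The scaling of the confidence width in OPLB. -/
def Params.κ (P : Params) : ℝ := 1 + 2 * P.Sθ / P.b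

/-- The confidence radius in dimension `d`; the time index may be any real number. -/
def Params.β (P : Params) (d : ℕ) (t : ℝ) : ℝ :=
  P.ρ * √(d * Real.log ((1 + (t - 1) / P.lam) / (P.δ / 2))) + √P.lam * P.S

/-- The action set, the reward vector, the constraint vector and the optimal action. -/
structure Env (d : ℕ) where
  X : Set (Vec d)
  θ : Vec d
  a : Vec d
  xstar : Vec d

variable {d : ℕ}

/-- The actions that satisfy the constraint with limit `b`. -/
def Env.feasible (E : Env d) (b : ℝ) : Set (Vec d) := {x ∈ E.X | inner ℝ E.a x ≤ b}

structure Env.Valid (E : Env d) (P : Params) : Prop where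
  closed : IsClosed E.X
  star : StarConvex ℝ 0 E.X
  norm_le : ∀ x ∈ E.X, ‖x‖ ≤ 1
  norm_a_le : ‖E.a‖ ≤ P.Sa
  norm_θ_le : ‖E.θ‖ ≤ P.Sθ
  xstar_mem : E.xstar ∈ E.feasible P.b
  xstar_max : IsMaxOn (fun x => inner ℝ E.θ x) (E.feasible P.b) E.xstar
  reward_pos : 0 < inner ℝ E.θ E.xstar

/-- `x` is a positive multiple of `u`. -/
def SameDir (x u : Vec d) : Prop := ∃ α : ℝ, 0 < α ∧ x = α • u

/-- The reward gap: the infimum of the loss over the feasible actions that are not a positive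
multiple of the optimal action. -/
def Env.gap (E : Env d) (b : ℝ) : ℝ :=
  sInf ((fun x => inner ℝ E.θ (E.xstar - x)) '' {x ∈ E.feasible b | ¬ SameDir x E.xstar})

/-! Rounds are numbered from `1`; the entry with index `0` of a sequence is never used. -/

/-- `V_t`, formed from the actions of rounds `1, …, t - 1`. -/
def design (lam : ℝ) (x : ℕ → Vec d) (t : ℕ) : Matrix (Fin d) (Fin d) ℝ :=
  ∑ k ∈ Finset.Ico 1 t, Matrix.vecMulVec (x k).ofLp (x k).ofLp
    + lam • (1 : Matrix (Fin d) (Fin d) ℝ)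

/-- The regularized least-squares estimate from the observations `w` of rounds `1, …, t - 1`. -/
def estimate (lam : ℝ) (x : ℕ → Vec d) (w : ℕ → ℝ) (t : ℕ) : Vec d :=
  WithLp.toLp 2 ((design lam x t)⁻¹ *ᵥ (∑ k ∈ Finset.Ico 1 t, w k • x k).ofLp)

/-- The weighted norm `√(vᵀ M v)`. -/
def wnorm (M : Matrix (Fin d) (Fin d) ℝ) (v : Vec d) : ℝ := √(v.ofLp ⬝ᵥ M *ᵥ v.ofLp)

/-- The pessimistic action set of round `t`, from the actions `x` and the constraint
observations `z` of the previous rounds. -/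
def pess (P : Params) (X : Set (Vec d)) (x : ℕ → Vec d) (z : ℕ → ℝ) (t : ℕ) : Set (Vec d) :=
  {v ∈ X | inner ℝ (estimate P.lam x z t) v
    + P.β d t * wnorm (design P.lam x t)⁻¹ v ≤ P.b}

/-- The scaled upper confidence bound on the reward. -/
def ucb (P : Params) (x : ℕ → Vec d) (y : ℕ → ℝ) (t : ℕ) (v : Vec d) : ℝ :=
  inner ℝ (estimate P.lam x y t) v + P.κ * P.β d t * wnorm (design P.lam x t)⁻¹ v

/-- In round `t` the action `x t` is chosen by the OPLB rule. -/
def OPLBStep (P : Params) (X : Set (Vec d)) (x : ℕ → Vec d) (y z : ℕ → ℝ) (t : ℕ) : Prop :=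
  x t ∈ pess P X x z t ∧ IsMaxOn (ucb P x y t) (pess P X x z t) (x t)

open Classical in
/-- The number of rounds among `1, …, n` whose action has the direction `u`. -/
def dirCount (x : ℕ → Vec d) (u : Vec d) (n : ℕ) : ℕ :=
  ((Finset.Icc 1 n).filter fun t => SameDir (x t) u).card

open Classical in
/-- The number of rounds among `1, …, T` whose action is not a positive multiple of the optimal
action. -/
def Env.wrongCount (E : Env d) (x : ℕ → Vec d) (T : ℕ) : ℕ :=
  ((Finset.Icc 1 T).filter fun t => ¬ SameDir (x t) E.xstar).card

def Env.regret (E : Env d) (x : ℕ → Vec d) (T : ℕ) : ℝ :=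
  ∑ t ∈ Finset.Icc 1 T, inner ℝ E.θ (E.xstar - x t)

/-- The bound on the number of wrong directions (and the threshold of PD-OPLB). -/
def Env.Bbar (E : Env d) (P : Params) (T : ℕ) : ℝ :=
  8 * d * (1 + 2 * P.S / P.b) ^ 2 * P.β d T ^ 2 * Real.log (1 + T / (P.lam * d))
    / E.gap P.b ^ 2

/-- After round `n`, for the first time, some direction has been played more than `B` times, and
the unit vector `u` is such a direction. -/
def Switch (B : ℝ) (x : ℕ → Vec d) (n : ℕ) (u : Vec d) : Prop :=
  ‖u‖ = 1 ∧ B < dirCount x u n ∧ ∀ k < n, ∀ v : Vec d, ‖v‖ = 1 → (dirCount x v k : ℝ) ≤ B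

/-- One-dimensional design along `u`, reinitialized after round `n`: the coordinates of the actions
of rounds `n + 1, …, t - 1` are used. -/
def design1 (lam : ℝ) (x : ℕ → Vec d) (u : Vec d) (n t : ℕ) : ℝ :=
  lam + ∑ s ∈ Finset.Ico (n + 1) t, (inner ℝ u (x s)) ^ 2

/-- One-dimensional least-squares estimate of `⟪a, u⟫`, reinitialized after round `n`. -/
def estimate1 (lam : ℝ) (x : ℕ → Vec d) (z : ℕ → ℝ) (u : Vec d) (n t : ℕ) : ℝ :=
  (∑ s ∈ Finset.Ico (n + 1) t, inner ℝ u (x s) * z s) / design1 lam x u n t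

/-- The scalars `ξ` for which `ξ • u` is in the reinitialized pessimistic action set of round `t`,
with the one-dimensional confidence radius; round `n + 1` has index `1` in the second phase. -/
def pess1 (P : Params) (X : Set (Vec d)) (x : ℕ → Vec d) (z : ℕ → ℝ) (u : Vec d) (n t : ℕ) :
    Set ℝ :=
  {ξ | ξ • u ∈ X ∧ estimate1 P.lam x z u n t * ξ
    + P.β 1 ((t : ℝ) - n) * (|ξ| / √(design1 P.lam x u n t)) ≤ P.b}

/-- In round `t` the action `x t` is chosen by PD-OPLB with threshold `B`. -/
def PDOPLBStep (P : Params) (X : Set (Vec d)) (B : ℝ) (x : ℕ → Vec d) (y z : ℕ → ℝ) (t : ℕ) :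
    Prop :=
  ((∀ n < t, ∀ u, ¬ Switch B x n u) → OPLBStep P X x y z t) ∧
  ∀ n < t, ∀ u, Switch B x n u →
    ∃ ξ, IsGreatest (pess1 P X x z u n t) ξ ∧ x t = ξ • u

/-- The random actions and noise terms of an interaction. -/
structure Run (d : ℕ) (Ω : Type*) where
  x : ℕ → Ω → Vec d
  ε : ℕ → Ω → ℝ
  η : ℕ → Ω → ℝ

variable {Ω : Type*}

/-- The sequence of actions at the outcome `ω`. -/
def Run.act (R : Run d Ω) (ω : Ω) (t : ℕ) : Vec d := R.x t ω

/-- The rewards. -/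
def Run.y (R : Run d Ω) (E : Env d) (ω : Ω) (t : ℕ) : ℝ := inner ℝ E.θ (R.x t ω) + R.ε t ω

/-- The constraint observations. -/
def Run.z (R : Run d Ω) (E : Env d) (ω : Ω) (t : ℕ) : ℝ := inner ℝ E.a (R.x t ω) + R.η t ω

/-- The σ-algebra generated by the actions of rounds `1, …, t` and the noise terms of rounds
`1, …, t - 1`. -/
@[reducible] def history (x : ℕ → Ω → Vec d) (noise : ℕ → Ω → ℝ) (t : ℕ) : MeasurableSpace Ω :=
  (⨆ k ∈ Finset.Icc 1 t, MeasurableSpace.comap (x k) inferInstance) ⊔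
    ⨆ k ∈ Finset.Ico 1 t, MeasurableSpace.comap (noise k) inferInstance

/-- The noise terms of rounds `1, …, T` have conditional mean zero and are conditionally
`ρ`-subgaussian given the history. -/
structure SubgaussianNoise [MeasurableSpace Ω] (μ : Measure Ω) (ρ : ℝ) (T : ℕ)
    (x : ℕ → Ω → Vec d) (noise : ℕ → Ω → ℝ) : Prop where
  integrable : ∀ t ∈ Finset.Icc 1 T, Integrable (noise t) μ
  mean : ∀ t ∈ Finset.Icc 1 T, μ[noise t | history x noise t] =ᵐ[μ] 0
  integrable_exp : ∀ t ∈ Finset.Icc 1 T, ∀ s : ℝ,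
    Integrable (fun ω => Real.exp (s * noise t ω)) μ
  mgf : ∀ t ∈ Finset.Icc 1 T, ∀ s : ℝ,
    μ[fun ω => Real.exp (s * noise t ω) | history x noise t]
      ≤ᵐ[μ] fun _ => Real.exp (s ^ 2 * ρ ^ 2 / 2)

structure Run.Valid [MeasurableSpace Ω] (R : Run d Ω) (μ : Measure Ω) (ρ : ℝ) (T : ℕ) : Prop where
  meas_x : ∀ t, Measurable (R.x t)
  meas_ε : ∀ t, Measurable (R.ε t)
  meas_η : ∀ t, Measurable (R.η t)
  noise_ε : SubgaussianNoise μ ρ T R.x R.ε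
  noise_η : SubgaussianNoise μ ρ T R.x R.η

/-- The actions of rounds `1, …, T` are chosen by OPLB. -/
def Run.IsOPLB [MeasurableSpace Ω] (R : Run d Ω) (μ : Measure Ω) (P : Params) (E : Env d)
    (T : ℕ) : Prop :=
  ∀ᵐ ω ∂μ, ∀ t ∈ Finset.Icc 1 T, OPLBStep P E.X (R.act ω) (R.y E ω) (R.z E ω) t

/-- The actions of rounds `1, …, T` are chosen by PD-OPLB. -/
def Run.IsPDOPLB [MeasurableSpace Ω] (R : Run d Ω) (μ : Measure Ω) (P : Params) (E : Env d)
    (T : ℕ) : Prop :=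
  ∀ᵐ ω ∂μ, ∀ t ∈ Finset.Icc 1 T,
    PDOPLBStep P E.X (E.Bbar P T) (R.act ω) (R.y E ω) (R.z E ω) t

end SafeBandit

end

/-! Everything happens on one confidence event. The engine is a self-normalized tail bound: `p ^
(-1/2) * exp (Q / (2 ρ²))` is a nonnegative supermartingale started at 1, where `Q` is the squared
`V⁻¹`-norm of the weighted noise sum and `p` is the determinant ratio of the design.
`measure_exists_lt_quadratic_le` proves this from the recursions of `Q` and `p` alone, so one
argument serves the `d`-dimensional estimates, used for both noise sequences at level `δ / 2`, and
the scalar estimate along one direction, used at level `δ`.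

On the event, pessimism makes every OPLB action feasible. A scaled copy of the optimal action lies
in the pessimistic set, and the factor `κ` of the optimistic bonus pays for the scaling, so one
round costs at most `2 (1 + S/b) β` times the weighted norm of its action (`OPLBStep.regret_le`).
The elliptical potential lemma bounds the sum of the squared costs. A feasible action in a wrong
direction costs at least the gap `Δ`, so `Δ²` times the number of wrong rounds is at most that sum.

This count contains `1 + S/b` where the threshold contains `1 + 2S/b`. As `S/b ≥ 1`, wrong rounds
number at most 4/9 of the threshold. Hence only the optimal direction can exceed the threshold
(`GoodOPLB.eq_dir_of_switch`), and the first phase lasts at most twice the threshold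
(`GoodOPLB.length_le`).

After the switch the problem is one-dimensional. The chosen scalar is maximal, so it is at least a
shrunken copy of the optimal scalar, and the shrinkage depends on the scalars already played
(`second_phase_self_bound`). Telescoping potentials turn this into a loss of order `√T` plus a
logarithmic term (`sum_one_sub_div_le`). A switch can occur only if `T` is at least the threshold,
and this lower bound on `T` absorbs the logarithmic term (`second_phase_numeric`). The switching
round is random, but on the event its direction is the fixed direction of the optimal action, so
predictable weights (`phaseWeight`) reduce the second phase to a single use of the scalar tail
bound. -/

noncomputable section

namespace SafeBandit

/-! ### Conditional subgaussianity, the method of mixtures and a maximal inequality -/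

section Subgaussian

variable {Ω : Type*} {F m0 : MeasurableSpace Ω} {μ : Measure Ω} [IsProbabilityMeasure μ]

lemma setLIntegral_exp_le (hF : F ≤ m0) {f : Ω → ℝ} (hf0 : ∀ ω, 0 ≤ f ω) (hf : Integrable f μ)
    {K : ℝ} (hK : μ[f | F] ≤ᵐ[μ] fun _ => K) {A : Set Ω} (hA : MeasurableSet[F] A) :
    ∫⁻ ω in A, ENNReal.ofReal (f ω) ∂μ ≤ ENNReal.ofReal K * μ A := by
  rw [← ofReal_integral_eq_lintegral_ofReal hf.restrict (ae_of_all _ hf0),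
    ← setIntegral_condExp hF hf hA]
  have h : ∫ ω in A, (μ[f | F]) ω ∂μ ≤ ∫ ω in A, K ∂μ :=
    integral_mono_ae integrable_condExp.restrict (integrable_const _) (ae_restrict_of_ae hK)
  refine (ENNReal.ofReal_le_ofReal h).trans ?_
  rw [setIntegral_const, smul_eq_mul, mul_comm]
  rcases le_or_gt 0 K with h0 | h0
  · rw [ENNReal.ofReal_mul h0, ofReal_measureReal]
  · rw [ENNReal.ofReal_of_nonpos (mul_nonpos_of_nonpos_of_nonneg h0.le measureReal_nonneg)]
    exact zero_le

/-- Restricted to `F`, the measure with density `f` is dominated by `K` times `μ`. Comparing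
measures rather than conditional expectations lets `G` be any nonnegative `F`-measurable function,
without integrability. -/
lemma lintegral_mul_ofReal_le (hF : F ≤ m0) {f : Ω → ℝ} (hfm : Measurable f) (hf0 : ∀ ω, 0 ≤ f ω)
    (hf : Integrable f μ) {K : ℝ} (hK : μ[f | F] ≤ᵐ[μ] fun _ => K)
    {G : Ω → ENNReal} (hG : Measurable[F] G) :
    ∫⁻ ω, G ω * ENNReal.ofReal (f ω) ∂μ ≤ ENNReal.ofReal K * ∫⁻ ω, G ω ∂μ := by
  have h1 : (μ.withDensity fun ω => ENNReal.ofReal (f ω)).trim hF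
      ≤ ENNReal.ofReal K • μ.trim hF := by
    refine Measure.le_iff.2 fun A hA => ?_
    rw [trim_measurableSet_eq hF hA, Measure.smul_apply, trim_measurableSet_eq hF hA,
      withDensity_apply _ (hF _ hA)]
    exact setLIntegral_exp_le hF hf0 hf hK hA
  have h2 : ∫⁻ ω, G ω * ENNReal.ofReal (f ω) ∂μ
      = ∫⁻ ω, G ω ∂(μ.withDensity fun ω => ENNReal.ofReal (f ω)) := by
    rw [lintegral_withDensity_eq_lintegral_mul _ hfm.ennreal_ofReal (hG.mono hF le_rfl)]
    exact lintegral_congr fun ω => mul_comm _ _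
  rw [h2, ← lintegral_trim hF hG, ← lintegral_trim hF hG]
  refine (lintegral_mono' h1 le_rfl).trans_eq ?_
  rw [lintegral_smul_measure, smul_eq_mul]

/-- Conditional subgaussianity for a random argument of the moment generating function. -/
lemma lintegral_mul_exp_le (hF : F ≤ m0) {ρ : ℝ} {η : Ω → ℝ} (hη : Measurable η)
    (hint : ∀ s : ℝ, Integrable (fun ω => Real.exp (s * η ω)) μ)
    (hmgf : ∀ s : ℝ, μ[fun ω => Real.exp (s * η ω) | F]
      ≤ᵐ[μ] fun _ => Real.exp (s ^ 2 * ρ ^ 2 / 2))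
    {G : Ω → ENNReal} (hG : Measurable[F] G) {s : Ω → ℝ} (hs : Measurable[F] s) :
    ∫⁻ ω, G ω * ENNReal.ofReal (Real.exp (s ω * η ω - s ω ^ 2 * ρ ^ 2 / 2)) ∂μ
      ≤ ∫⁻ ω, G ω ∂μ := by
  have hsS : StronglyMeasurable[F] s := hs.stronglyMeasurable
  -- The hypothesis bounds the moment generating function for each fixed argument. A random argument
  -- with finitely many values is handled on each of its level sets; the general case follows by
  -- simple approximation and Fatou's lemma.
  have hsimple : ∀ σ : Ω → ℝ, Measurable[F] σ → (Set.range σ).Finite →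
      ∫⁻ ω, G ω * ENNReal.ofReal (Real.exp (σ ω * η ω - σ ω ^ 2 * ρ ^ 2 / 2)) ∂μ
        ≤ ∫⁻ ω, G ω ∂μ := by
    intro σ hσF hfin
    have hpart : ∀ H : Ω → ENNReal,
        H = fun ω => ∑ c ∈ hfin.toFinset, (σ ⁻¹' {c}).indicator H ω := by
      intro H
      funext ω
      rw [Finset.sum_eq_single (σ ω)]
      · simp
      · intro c _ hc
        simp [Set.indicator, hc.symm]
      · intro h
        exact absurd (hfin.mem_toFinset.2 ⟨ω, rfl⟩) h
    have hms : ∀ c, MeasurableSet[F] (σ ⁻¹' {c}) := fun c =>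
      hσF (measurableSet_singleton c)
    have hσ : Measurable[m0] σ := hσF.mono hF le_rfl
    have hGm : Measurable[m0] G := hG.mono hF le_rfl
    rw [hpart (fun ω => G ω * ENNReal.ofReal (Real.exp (σ ω * η ω - σ ω ^ 2 * ρ ^ 2 / 2))),
      lintegral_congr (fun ω => congrFun (hpart G) ω), lintegral_finsetSum, lintegral_finsetSum]
    rotate_left
    · exact fun c _ => hGm.indicator (hF _ (hms c))
    · exact fun c _ => Measurable.indicator (by fun_prop) (hF _ (hms c))
    refine Finset.sum_le_sum fun c _ => ?_
    have hGc : Measurable[F] ((σ ⁻¹' {c}).indicator G) := hG.indicator (hms c)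
    have h := lintegral_mul_ofReal_le hF (f := fun ω => Real.exp (c * η ω)) (by fun_prop)
      (fun ω => (Real.exp_pos _).le) (hint c) (hmgf c) hGc
    have hK : ENNReal.ofReal (Real.exp (-(c ^ 2 * ρ ^ 2 / 2)))
        * ENNReal.ofReal (Real.exp (c ^ 2 * ρ ^ 2 / 2)) = 1 := by
      rw [← ENNReal.ofReal_mul (Real.exp_pos _).le, ← Real.exp_add]
      simp
    calc ∫⁻ ω, (σ ⁻¹' {c}).indicator
          (fun ω => G ω * ENNReal.ofReal (Real.exp (σ ω * η ω - σ ω ^ 2 * ρ ^ 2 / 2))) ω ∂μ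
        = ∫⁻ ω, ENNReal.ofReal (Real.exp (-(c ^ 2 * ρ ^ 2 / 2)))
          * ((σ ⁻¹' {c}).indicator G ω * ENNReal.ofReal (Real.exp (c * η ω))) ∂μ := by
          refine lintegral_congr fun ω => ?_
          by_cases hω : σ ω = c
          · simp only [Set.indicator, Set.mem_preimage, Set.mem_singleton_iff, hω, if_true]
            rw [sub_eq_add_neg, Real.exp_add, ENNReal.ofReal_mul (Real.exp_pos _).le]
            ring
          · simp [Set.indicator, hω]
      _ ≤ _ := by
          rw [lintegral_const_mul _ (by
            exact (hGc.mono hF le_rfl).mul (by fun_prop))]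
          calc _ ≤ _ := mul_le_mul_right h _
            _ = _ := by rw [← mul_assoc, hK, one_mul]
  have hlim : ∀ ω, Filter.Tendsto
      (fun n => G ω * ENNReal.ofReal (Real.exp (hsS.approx n ω * η ω
        - hsS.approx n ω ^ 2 * ρ ^ 2 / 2))) Filter.atTop
      (nhds (G ω * ENNReal.ofReal (Real.exp (s ω * η ω - s ω ^ 2 * ρ ^ 2 / 2)))) := by
    intro ω
    have h := hsS.tendsto_approx ω
    refine ENNReal.Tendsto.const_mul ?_ (Or.inl ?_)
    · refine ENNReal.tendsto_ofReal ((Real.continuous_exp.tendsto _).comp ?_)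
      exact (h.mul_const _).sub (((h.pow 2).mul_const _).div_const _)
    · exact (ENNReal.ofReal_pos.2 (Real.exp_pos _)).ne'
  calc ∫⁻ ω, G ω * ENNReal.ofReal (Real.exp (s ω * η ω - s ω ^ 2 * ρ ^ 2 / 2)) ∂μ
      = ∫⁻ ω, Filter.liminf (fun n => G ω * ENNReal.ofReal (Real.exp (hsS.approx n ω * η ω
        - hsS.approx n ω ^ 2 * ρ ^ 2 / 2))) Filter.atTop ∂μ :=
        lintegral_congr fun ω => ((hlim ω).liminf_eq).symm
    _ ≤ Filter.liminf (fun n => ∫⁻ ω, G ω * ENNReal.ofReal (Real.exp (hsS.approx n ω * η ω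
        - hsS.approx n ω ^ 2 * ρ ^ 2 / 2)) ∂μ) Filter.atTop := by
        refine lintegral_liminf_le fun n => ?_
        have h1 : Measurable[m0] (hsS.approx n) :=
          (@SimpleFunc.measurable Ω ℝ F _ (hsS.approx n)).mono hF le_rfl
        have h2 : Measurable[m0] G := hG.mono hF le_rfl
        fun_prop
    _ ≤ ∫⁻ ω, G ω ∂μ := by
        refine Filter.liminf_le_of_frequently_le' (Filter.Frequently.of_forall fun n => ?_)
        exact hsimple _ (@SimpleFunc.measurable Ω ℝ F _ (hsS.approx n))
          (@SimpleFunc.finite_range Ω ℝ F (hsS.approx n))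

open ProbabilityTheory in
/-- The Gaussian mixture of the exponential functions `exp (s x - s² ρ² / 2)`. -/
lemma lintegral_gaussian_mixture {ρ w : ℝ} (hρ : 0 < ρ) (hw : 0 ≤ w) (m x : ℝ) :
    ∫⁻ g, ENNReal.ofReal (Real.exp ((m / ρ ^ 2 + √w / ρ * g) * x
        - (m / ρ ^ 2 + √w / ρ * g) ^ 2 * ρ ^ 2 / 2)) ∂(gaussianReal 0 1)
      = ENNReal.ofReal ((√(1 + w))⁻¹
        * Real.exp ((x ^ 2 * w + 2 * x * m - m ^ 2) / (1 + w) / (2 * ρ ^ 2))) := by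
  have hw1 : 0 < 1 + w := by linarith
  set v : NNReal := ⟨(1 + w)⁻¹, (inv_pos.2 hw1).le⟩ with hv
  have hv0 : v ≠ 0 := by
    intro h
    exact (inv_pos.2 hw1).ne' (congrArg NNReal.toReal h)
  have hvr : (v : ℝ) = (1 + w)⁻¹ := rfl
  set c : ℝ := (√(1 + w))⁻¹
    * Real.exp ((x ^ 2 * w + 2 * x * m - m ^ 2) / (1 + w) / (2 * ρ ^ 2)) with hc
  have hc0 : 0 ≤ c := by positivity
  rw [gaussianReal_of_var_ne_zero _ one_ne_zero,
    lintegral_withDensity_eq_lintegral_mul _ (measurable_gaussianPDF _ _) (by fun_prop)]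
  -- Completing the square in `g`: the integrand times the standard Gaussian density is a constant
  -- times the density of a Gaussian with variance `1 / (1 + w)`.
  have hpt : ∀ g : ℝ, (gaussianPDF 0 1 * fun g => ENNReal.ofReal (Real.exp
        ((m / ρ ^ 2 + √w / ρ * g) * x - (m / ρ ^ 2 + √w / ρ * g) ^ 2 * ρ ^ 2 / 2))) g
      = ENNReal.ofReal c * gaussianPDF (√w * (x - m) / ρ / (1 + w)) v g := by
    intro g
    simp only [Pi.mul_apply, gaussianPDF]
    rw [← ENNReal.ofReal_mul (gaussianPDFReal_nonneg _ _ _), ← ENNReal.ofReal_mul hc0]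
    congr 1
    simp only [gaussianPDFReal, hvr, hc, NNReal.coe_one, mul_one, sub_zero]
    have e1 : (√(2 * Real.pi * (1 + w)⁻¹))⁻¹ = (√(2 * Real.pi))⁻¹ * √(1 + w) := by
      rw [Real.sqrt_mul (by positivity), Real.sqrt_inv, mul_inv, inv_inv]
    rw [e1, mul_assoc, ← Real.exp_add]
    have h0 : √(1 + w) ≠ 0 := (Real.sqrt_pos.2 hw1).ne'
    have e2 : (√(1 + w))⁻¹ * Real.exp ((x ^ 2 * w + 2 * x * m - m ^ 2) / (1 + w) / (2 * ρ ^ 2))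
        * ((√(2 * Real.pi))⁻¹ * √(1 + w)
          * Real.exp (-(g - √w * (x - m) / ρ / (1 + w)) ^ 2 / (2 * (1 + w)⁻¹)))
        = (√(2 * Real.pi))⁻¹ * Real.exp ((x ^ 2 * w + 2 * x * m - m ^ 2) / (1 + w) / (2 * ρ ^ 2)
          + -(g - √w * (x - m) / ρ / (1 + w)) ^ 2 / (2 * (1 + w)⁻¹)) := by
      rw [Real.exp_add]
      field_simp
    rw [e2]
    congr 2
    have hsw : √w ^ 2 = w := Real.sq_sqrt hw
    generalize √w = q at hsw
    subst hsw
    field_simp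
    ring
  rw [lintegral_congr hpt, lintegral_const_mul _ (measurable_gaussianPDF _ _),
    lintegral_gaussianPDF_eq_one _ hv0, mul_one]

open ProbabilityTheory in
/-- One step of the method of mixtures. -/
lemma lintegral_mul_mixture_le (hF : F ≤ m0) {ρ : ℝ} (hρ : 0 < ρ) {η : Ω → ℝ} (hη : Measurable η)
    (hint : ∀ s : ℝ, Integrable (fun ω => Real.exp (s * η ω)) μ)
    (hmgf : ∀ s : ℝ, μ[fun ω => Real.exp (s * η ω) | F]
      ≤ᵐ[μ] fun _ => Real.exp (s ^ 2 * ρ ^ 2 / 2))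
    {G : Ω → ENNReal} (hG : Measurable[F] G) {w m : Ω → ℝ} (hw : Measurable[F] w)
    (hw0 : ∀ ω, 0 ≤ w ω) (hm : Measurable[F] m) :
    ∫⁻ ω, G ω * ENNReal.ofReal ((√(1 + w ω))⁻¹ * Real.exp
        ((η ω ^ 2 * w ω + 2 * η ω * m ω - m ω ^ 2) / (1 + w ω) / (2 * ρ ^ 2))) ∂μ
      ≤ ∫⁻ ω, G ω ∂μ := by
  have hwm : Measurable[m0] w := hw.mono hF le_rfl
  have hmm : Measurable[m0] m := hm.mono hF le_rfl
  have hGm : Measurable[m0] G := hG.mono hF le_rfl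
  -- The argument `m / ρ² + √w / ρ * g` has the posterior law, given the past, of the coordinate of
  -- a Gaussian parameter along the new action. Mixing one round at a time with this law avoids a
  -- `d`-dimensional Gaussian integral.
  calc _ = ∫⁻ ω, ∫⁻ g, G ω * ENNReal.ofReal (Real.exp
          ((m ω / ρ ^ 2 + √(w ω) / ρ * g) * η ω
          - (m ω / ρ ^ 2 + √(w ω) / ρ * g) ^ 2 * ρ ^ 2 / 2)) ∂(gaussianReal 0 1) ∂μ := by
        refine lintegral_congr fun ω => ?_
        rw [lintegral_const_mul _ (by fun_prop), lintegral_gaussian_mixture hρ (hw0 ω)]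
    _ = ∫⁻ g, ∫⁻ ω, G ω * ENNReal.ofReal (Real.exp
          ((m ω / ρ ^ 2 + √(w ω) / ρ * g) * η ω
          - (m ω / ρ ^ 2 + √(w ω) / ρ * g) ^ 2 * ρ ^ 2 / 2)) ∂μ ∂(gaussianReal 0 1) := by
        refine lintegral_lintegral_swap (Measurable.aemeasurable ?_)
        unfold Function.uncurry
        fun_prop
    _ ≤ ∫⁻ _, ∫⁻ ω, G ω ∂μ ∂(gaussianReal 0 1) := by
        refine lintegral_mono fun g => ?_
        refine lintegral_mul_exp_le hF hη hint hmgf hG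
          (s := fun ω => m ω / ρ ^ 2 + √(w ω) / ρ * g) ?_
        exact (hm.div_const _).add ((hw.sqrt.div_const _).mul_const _)
    _ = _ := by simp

omit [IsProbabilityMeasure μ] in
/-- A maximal inequality for nonnegative supermartingales on rounds `1, …, N`. -/
lemma measure_exists_ge_le {F : ℕ → MeasurableSpace Ω} (hF : ∀ t, F t ≤ m0) (hmono : Monotone F)
    {D : ℕ → Ω → ENNReal} (hD : ∀ t, 1 ≤ t → Measurable[F t] (D t)) {N : ℕ}
    (hsup : ∀ t, 1 ≤ t → t < N → ∀ A, MeasurableSet[F t] A →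
      ∫⁻ ω in A, D (t + 1) ω ∂μ ≤ ∫⁻ ω in A, D t ω ∂μ) (c : ENNReal) (hN : 1 ≤ N) :
    c * μ {ω | ∃ t, 1 ≤ t ∧ t ≤ N ∧ c ≤ D t ω} ≤ ∫⁻ ω, D 1 ω ∂μ := by
  set H : ℕ → Set Ω := fun n => {ω | ∃ t, 1 ≤ t ∧ t ≤ n ∧ c ≤ D t ω} with hH
  have hHm : ∀ n, 1 ≤ n → MeasurableSet[F n] (H n) := by
    intro n _
    have : H n = ⋃ t ∈ Finset.Icc 1 n, {ω | c ≤ D t ω} := by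
      ext ω
      simp [hH, and_assoc]
    rw [this]
    refine Finset.measurableSet_biUnion _ fun t ht => ?_
    rw [Finset.mem_Icc] at ht
    exact hmono ht.2 _ (measurableSet_le measurable_const (hD t ht.1))
  -- The process is stopped when it first reaches `c`: the outcomes that have reached `c` contribute
  -- `c` each, and the supermartingale property is needed only on the others.
  have hind : ∀ n, 1 ≤ n → n ≤ N →
      c * μ (H n) + ∫⁻ ω in (H n)ᶜ, D n ω ∂μ ≤ ∫⁻ ω, D 1 ω ∂μ := by
    intro n hn
    induction n, hn using Nat.le_induction with
    | base =>
      intro _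
      rw [← lintegral_add_compl (μ := μ) (D 1) (hF 1 _ (hHm 1 le_rfl))]
      have h : c * μ (H 1) ≤ ∫⁻ ω in H 1, D 1 ω ∂μ := by
        rw [← setLIntegral_const]
        refine setLIntegral_mono' (hF 1 _ (hHm 1 le_rfl)) ?_
        rintro ω ⟨t, h1, h2, h3⟩
        obtain rfl : t = 1 := le_antisymm h2 h1
        exact h3
      exact add_le_add h le_rfl
    | succ n hn ih =>
      intro hnN
      refine le_trans ?_ (ih (by omega))
      have h1 := hsup n hn (by omega) _ (hHm n hn).compl
      set B : Set Ω := H (n + 1) \ H n with hB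
      have hBm : MeasurableSet B :=
        (hF _ _ (hHm (n + 1) (by omega))).diff (hF _ _ (hHm n hn))
      have hsub : H n ⊆ H (n + 1) := by
        rintro ω ⟨t, h1, h2, h3⟩
        exact ⟨t, h1, by omega, h3⟩
      have hHB : μ (H (n + 1)) = μ (H n) + μ B := by
        rw [← measure_union Set.disjoint_sdiff_right hBm, Set.union_sdiff_cancel hsub]
      have hcB : c * μ B ≤ ∫⁻ ω in B, D (n + 1) ω ∂μ := by
        rw [← setLIntegral_const]
        refine setLIntegral_mono' hBm ?_
        rintro ω ⟨⟨t, h1, h2, h3⟩, h4⟩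
        rcases Nat.lt_or_ge n t with h | h
        · obtain rfl : t = n + 1 := le_antisymm h2 h
          exact h3
        · exact absurd ⟨t, h1, h, h3⟩ h4
      have hsplit : ∫⁻ ω in (H n)ᶜ, D (n + 1) ω ∂μ
          = ∫⁻ ω in B, D (n + 1) ω ∂μ + ∫⁻ ω in (H (n + 1))ᶜ, D (n + 1) ω ∂μ := by
        rw [← lintegral_union (hF _ _ (hHm (n + 1) (by omega))).compl]
        · congr 2
          ext ω
          by_cases h1 : ω ∈ H n
          · simp [hB, h1, hsub h1]
          · by_cases h2 : ω ∈ H (n + 1) <;> simp [hB, h1, h2]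
        · exact Set.disjoint_left.2 fun ω h1 h2 => h2 h1.1
      rw [hsplit] at h1
      rw [hHB, mul_add, add_assoc]
      gcongr
      exact (add_le_add_left hcB _).trans h1
  exact le_trans le_self_add (hind N hN le_rfl)

end Subgaussian

/-! ### Quadratic forms of the inverse under rank-one updates -/

section LinearAlgebra

variable {ι : Type*} [Fintype ι] [DecidableEq ι] {V : Matrix ι ι ℝ}

lemma det_add_vecMulVec_self (hV : V.PosDef) (x : ι → ℝ) :
    (V + Matrix.vecMulVec x x).det = V.det * (1 + x ⬝ᵥ V⁻¹ *ᵥ x) := by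
  rw [Matrix.vecMulVec_eq Unit,
    Matrix.det_add_replicateCol_mul_replicateRow hV.det_pos.ne'.isUnit]
  congr 1
  rw [Matrix.det_unique, Matrix.add_apply, Matrix.one_apply_eq, Matrix.mul_assoc, ← Matrix.replicateCol_mulVec,
    Matrix.replicateRow_mul_replicateCol_apply]

lemma inv_dotProduct_comm (hV : V.PosDef) (x y : ι → ℝ) :
    x ⬝ᵥ V⁻¹ *ᵥ y = y ⬝ᵥ V⁻¹ *ᵥ x := by
  have h : (V⁻¹)ᵀ = V⁻¹ := by
    have := hV.inv.isHermitian
    rwa [Matrix.IsHermitian, Matrix.conjTranspose_eq_transpose_of_trivial] at this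
  rw [Matrix.dotProduct_mulVec, ← Matrix.mulVec_transpose, h, dotProduct_comm]

lemma inv_dotProduct_nonneg (hV : V.PosDef) (x : ι → ℝ) : 0 ≤ x ⬝ᵥ V⁻¹ *ᵥ x := by
  simpa using hV.inv.posSemidef.dotProduct_mulVec_nonneg x

lemma mulVec_inv_mulVec (hV : V.PosDef) (x : ι → ℝ) : V *ᵥ (V⁻¹ *ᵥ x) = x := by
  rw [Matrix.mulVec_mulVec, Matrix.mul_nonsing_inv _ hV.det_pos.ne'.isUnit, Matrix.one_mulVec]

lemma inv_mulVec_mulVec (hV : V.PosDef) (x : ι → ℝ) : V⁻¹ *ᵥ (V *ᵥ x) = x := by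
  rw [Matrix.mulVec_mulVec, Matrix.nonsing_inv_mul _ hV.det_pos.ne'.isUnit, Matrix.one_mulVec]

omit [DecidableEq ι] in
lemma posDef_add_vecMulVec_self (hV : V.PosDef) (x : ι → ℝ) :
    (V + Matrix.vecMulVec x x).PosDef := by
  have h := Matrix.posSemidef_vecMulVec_self_star (R := ℝ) x
  rw [star_trivial] at h
  exact hV.add_posSemidef h

/-- The effect of a rank-one update on the quadratic form of the inverse. -/
lemma inv_add_vecMulVec_dotProduct (hV : V.PosDef) (x s : ι → ℝ) (e : ℝ) :
    (s + e • x) ⬝ᵥ (V + Matrix.vecMulVec x x)⁻¹ *ᵥ (s + e • x)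
      = s ⬝ᵥ V⁻¹ *ᵥ s + (e ^ 2 * (x ⬝ᵥ V⁻¹ *ᵥ x) + 2 * e * (x ⬝ᵥ V⁻¹ *ᵥ s)
          - (x ⬝ᵥ V⁻¹ *ᵥ s) ^ 2) / (1 + x ⬝ᵥ V⁻¹ *ᵥ x) := by
  set w := x ⬝ᵥ V⁻¹ *ᵥ x with hw
  set m := x ⬝ᵥ V⁻¹ *ᵥ s with hm
  have hw0 : 0 ≤ w := inv_dotProduct_nonneg hV x
  have hw1 : 1 + w ≠ 0 := by linarith
  set c := (e - m) / (1 + w) with hc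
  -- Sherman–Morrison in solved form. Comparing the coefficients of `x` forces `c * (1 + w) + m =
  -- e`, which is the choice of `c`.
  have hsol : (V + Matrix.vecMulVec x x) *ᵥ (V⁻¹ *ᵥ s + c • (V⁻¹ *ᵥ x)) = s + e • x := by
    rw [Matrix.add_mulVec, Matrix.mulVec_add, Matrix.mulVec_smul, mulVec_inv_mulVec hV,
      mulVec_inv_mulVec hV, Matrix.vecMulVec_mulVec, dotProduct_add, dotProduct_smul, ← hw, ← hm]
    funext i
    simp only [Pi.add_apply, Pi.smul_apply, smul_eq_mul, MulOpposite.smul_eq_mul_unop,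
      MulOpposite.unop_op]
    have : c * (1 + w) = e - m := by rw [hc]; field_simp
    linear_combination (x i) * this
  rw [← hsol, inv_mulVec_mulVec (posDef_add_vecMulVec_self hV x), hsol]
  simp only [add_dotProduct, dotProduct_add, smul_dotProduct, dotProduct_smul, smul_eq_mul]
  rw [inv_dotProduct_comm hV s x, ← hw, ← hm, hc]
  field_simp
  ring

/-- Cauchy–Schwarz for the form of `V⁻¹`, from the discriminant of its nonnegative values at `t • x
+ y`. -/
lemma inv_dotProduct_sq_le (hV : V.PosDef) (x y : ι → ℝ) :
    (x ⬝ᵥ V⁻¹ *ᵥ y) ^ 2 ≤ (x ⬝ᵥ V⁻¹ *ᵥ x) * (y ⬝ᵥ V⁻¹ *ᵥ y) := by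
  have h := discrim_le_zero (a := x ⬝ᵥ V⁻¹ *ᵥ x) (b := 2 * (x ⬝ᵥ V⁻¹ *ᵥ y))
    (c := y ⬝ᵥ V⁻¹ *ᵥ y) fun t => by
      have h0 := inv_dotProduct_nonneg hV (t • x + y)
      simp only [Matrix.mulVec_add, Matrix.mulVec_smul, add_dotProduct, dotProduct_add,
        smul_dotProduct, dotProduct_smul, smul_eq_mul] at h0
      rw [inv_dotProduct_comm hV y x] at h0
      linarith
  rw [discrim] at h
  linarith

/-- With `y = V⁻¹ x`, the lower bound on `V` reads `lam * |y|² ≤ x · y`; combine it with `0 ≤ |x -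
lam * y|²`. -/
lemma inv_dotProduct_le {lam : ℝ} (hlam : 0 < lam) (hV : V.PosDef)
    (hle : ∀ y : ι → ℝ, lam * (y ⬝ᵥ y) ≤ y ⬝ᵥ V *ᵥ y) (x : ι → ℝ) :
    x ⬝ᵥ V⁻¹ *ᵥ x ≤ (x ⬝ᵥ x) / lam := by
  set y := V⁻¹ *ᵥ x with hy
  have h1 : V *ᵥ y = x := mulVec_inv_mulVec hV x
  have h2 := hle y
  rw [h1, dotProduct_comm y x] at h2
  have h3 : 0 ≤ (x - lam • y) ⬝ᵥ (x - lam • y) := by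
    simpa using dotProduct_star_self_nonneg (x - lam • y)
  simp only [sub_dotProduct, dotProduct_sub, smul_dotProduct, dotProduct_smul, smul_eq_mul] at h3
  rw [dotProduct_comm y x] at h3
  rw [le_div_iff₀ hlam]
  nlinarith

/-- The arithmetic–geometric mean inequality for the eigenvalues. -/
lemma det_le_trace_div_card_pow [Nonempty ι] (hV : V.PosDef) :
    V.det ≤ (V.trace / Fintype.card ι) ^ Fintype.card ι := by
  have hn : (0 : ℝ) < Fintype.card ι := by exact_mod_cast Fintype.card_pos
  have h := Real.geom_mean_le_arith_mean Finset.univ (fun _ : ι => (1 : ℝ)) hV.1.eigenvalues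
    (fun _ _ => zero_le_one) (by simpa using hn) (fun i _ => (hV.eigenvalues_pos i).le)
  simp only [Real.rpow_one, one_mul, Finset.sum_const, Finset.card_univ, nsmul_eq_mul,
    mul_one] at h
  have hd : V.det = ∏ i, hV.1.eigenvalues i := by simpa using hV.1.det_eq_prod_eigenvalues
  have ht : V.trace = ∑ i, hV.1.eigenvalues i := by simpa using hV.1.trace_eq_sum_eigenvalues
  rw [← hd, ← ht] at h
  calc V.det = (V.det ^ (Fintype.card ι : ℝ)⁻¹) ^ Fintype.card ι := by
        rw [Real.rpow_inv_natCast_pow hV.det_pos.le Fintype.card_ne_zero]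
    _ ≤ _ := pow_le_pow_left₀ (Real.rpow_nonneg hV.det_pos.le _) h _

end LinearAlgebra

/-! ### Design matrix, elliptical potential and least-squares error -/

section Design

variable {d : ℕ} {lam : ℝ}

lemma design_one (lam : ℝ) (x : ℕ → Vec d) : design lam x 1 = lam • 1 := by simp [design]

lemma design_succ (lam : ℝ) (x : ℕ → Vec d) {t : ℕ} (ht : 1 ≤ t) :
    design lam x (t + 1) = design lam x t + Matrix.vecMulVec (x t).ofLp (x t).ofLp := by
  rw [design, Finset.sum_Ico_succ_top ht, design]
  abel

lemma sum_vecMulVec_posSemidef (x : ℕ → Vec d) (s : Finset ℕ) :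
    (∑ k ∈ s, Matrix.vecMulVec (x k).ofLp (x k).ofLp).PosSemidef := by
  refine Matrix.posSemidef_sum _ fun k _ => ?_
  have h := Matrix.posSemidef_vecMulVec_self_star (R := ℝ) (x k).ofLp
  rwa [star_trivial] at h

lemma design_posDef (hlam : 0 < lam) (x : ℕ → Vec d) (t : ℕ) : (design lam x t).PosDef :=
  Matrix.PosDef.posSemidef_add (sum_vecMulVec_posSemidef x _) (Matrix.PosDef.one.smul hlam)

lemma le_design_dotProduct (x : ℕ → Vec d) (t : ℕ) (y : Fin d → ℝ) :
    lam * (y ⬝ᵥ y) ≤ y ⬝ᵥ design lam x t *ᵥ y := by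
  have h := (sum_vecMulVec_posSemidef x (Finset.Ico 1 t)).dotProduct_mulVec_nonneg y
  rw [star_trivial] at h
  rw [design, Matrix.add_mulVec, dotProduct_add, Matrix.smul_mulVec, Matrix.one_mulVec,
    dotProduct_smul, smul_eq_mul]
  linarith

lemma dotProduct_self_eq_norm_sq (v : Vec d) : v.ofLp ⬝ᵥ v.ofLp = ‖v‖ ^ 2 := by
  rw [EuclideanSpace.real_norm_sq_eq]
  simp [dotProduct, sq]

lemma inner_eq_dotProduct (u v : Vec d) : inner ℝ u v = u.ofLp ⬝ᵥ v.ofLp := by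
  rw [EuclideanSpace.inner_eq_star_dotProduct, star_trivial, dotProduct_comm]

lemma design_inv_dotProduct_le (hlam : 0 < lam) (x : ℕ → Vec d) (t : ℕ) (v : Vec d) :
    v.ofLp ⬝ᵥ (design lam x t)⁻¹ *ᵥ v.ofLp ≤ ‖v‖ ^ 2 / lam := by
  rw [← dotProduct_self_eq_norm_sq]
  exact inv_dotProduct_le hlam (design_posDef hlam x t) (le_design_dotProduct x t) _

lemma wnorm_sq (hlam : 0 < lam) (x : ℕ → Vec d) (t : ℕ) (v : Vec d) :
    wnorm (design lam x t)⁻¹ v ^ 2 = v.ofLp ⬝ᵥ (design lam x t)⁻¹ *ᵥ v.ofLp :=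
  Real.sq_sqrt (inv_dotProduct_nonneg (design_posDef hlam x t) _)

lemma wnorm_nonneg (M : Matrix (Fin d) (Fin d) ℝ) (v : Vec d) : 0 ≤ wnorm M v := Real.sqrt_nonneg _

lemma wnorm_smul (M : Matrix (Fin d) (Fin d) ℝ) {c : ℝ} (hc : 0 ≤ c) (v : Vec d) :
    wnorm M (c • v) = c * wnorm M v := by
  rw [wnorm, wnorm, WithLp.ofLp_smul, Matrix.mulVec_smul, smul_dotProduct, dotProduct_smul,
    smul_eq_mul, smul_eq_mul, ← mul_assoc, Real.sqrt_mul (mul_self_nonneg c),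
    Real.sqrt_mul_self hc]

/-- The determinant of the design matrix relative to the regularization. -/
def detRatio (lam : ℝ) (x : ℕ → Vec d) (t : ℕ) : ℝ := (design lam x t).det / lam ^ d

lemma detRatio_one (hlam : 0 < lam) (x : ℕ → Vec d) : detRatio lam x 1 = 1 := by
  simp [detRatio, design_one, hlam.ne']

lemma detRatio_succ (hlam : 0 < lam) (x : ℕ → Vec d) {t : ℕ} (ht : 1 ≤ t) :
    detRatio lam x (t + 1) = detRatio lam x t
      * (1 + (x t).ofLp ⬝ᵥ (design lam x t)⁻¹ *ᵥ (x t).ofLp) := by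
  rw [detRatio, design_succ lam x ht, det_add_vecMulVec_self (design_posDef hlam x t), detRatio]
  ring

lemma detRatio_pos (hlam : 0 < lam) (x : ℕ → Vec d) (t : ℕ) : 0 < detRatio lam x t :=
  div_pos (design_posDef hlam x t).det_pos (pow_pos hlam d)

lemma log_detRatio_le (hd : 1 ≤ d) (hlam : 0 < lam) (x : ℕ → Vec d) {t : ℕ} (ht : 1 ≤ t)
    (hx : ∀ k ∈ Finset.Ico 1 t, ‖x k‖ ≤ 1) :
    Real.log (detRatio lam x t) ≤ d * Real.log (1 + (t - 1) / (lam * d)) := by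
  have hd0 : (0 : ℝ) < d := by exact_mod_cast hd
  have : Nonempty (Fin d) := ⟨⟨0, hd⟩⟩
  have htr : (design lam x t).trace ≤ (t - 1) + lam * d := by
    rw [design, Matrix.trace_add, Matrix.trace_sum, Matrix.trace_smul, Matrix.trace_one,
      smul_eq_mul, Fintype.card_fin]
    have : ∑ k ∈ Finset.Ico 1 t, (Matrix.vecMulVec (x k).ofLp (x k).ofLp).trace
        ≤ ∑ k ∈ Finset.Ico 1 t, (1 : ℝ) := by
      refine Finset.sum_le_sum fun k hk => ?_
      rw [Matrix.trace_vecMulVec, dotProduct_self_eq_norm_sq]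
      exact pow_le_one₀ (norm_nonneg _) (hx k hk)
    simp only [Finset.sum_const, Nat.card_Ico, nsmul_eq_mul, mul_one, Nat.cast_sub ht,
      Nat.cast_one] at this
    linarith
  have h := det_le_trace_div_card_pow (design_posDef hlam x t)
  rw [Fintype.card_fin] at h
  have htr0 : 0 ≤ (design lam x t).trace := (design_posDef hlam x t).posSemidef.trace_nonneg
  have h2 : detRatio lam x t ≤ (1 + (t - 1) / (lam * d)) ^ d := by
    rw [detRatio, div_le_iff₀ (pow_pos hlam d), ← mul_pow]
    refine h.trans (pow_le_pow_left₀ (by positivity) ?_ _)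
    rw [div_le_iff₀ hd0]
    refine htr.trans (le_of_eq ?_)
    field_simp
    ring
  calc _ ≤ Real.log ((1 + (t - 1) / (lam * d)) ^ d) :=
        Real.log_le_log (detRatio_pos hlam x t) h2
    _ = _ := Real.log_pow _ _

lemma le_two_mul_log_one_add {w : ℝ} (h0 : 0 ≤ w) (h1 : w ≤ 1) : w ≤ 2 * Real.log (1 + w) := by
  have h := Real.one_sub_inv_le_log_of_pos (x := 1 + w) (by linarith)
  have : w / 2 ≤ 1 - (1 + w)⁻¹ := by
    rw [div_le_iff₀ two_pos, ← sub_nonneg]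
    have : (1 - (1 + w)⁻¹) * 2 - w = w * (1 - w) / (1 + w) := by
      field_simp
      ring
    rw [this]
    exact div_nonneg (mul_nonneg h0 (by linarith)) (by linarith)
  linarith

/-- The elliptical potential lemma. -/
lemma sum_wnorm_sq_le (hd : 1 ≤ d) (hlam : 1 ≤ lam) (x : ℕ → Vec d) {n : ℕ}
    (hx : ∀ k ∈ Finset.Icc 1 n, ‖x k‖ ≤ 1) :
    ∑ t ∈ Finset.Icc 1 n, wnorm (design lam x t)⁻¹ (x t) ^ 2
      ≤ 2 * (d * Real.log (1 + n / (lam * d))) := by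
  have hlam0 : 0 < lam := by linarith
  -- Each squared norm is at most 1, because `lam ≥ 1` and the actions lie in the unit ball. Hence
  -- `w ≤ 2 log (1 + w)`, and these logarithms telescope to the log-determinant.
  have key : ∀ m ≤ n, ∑ t ∈ Finset.Icc 1 m, wnorm (design lam x t)⁻¹ (x t) ^ 2
      ≤ 2 * Real.log (detRatio lam x (m + 1)) := by
    intro m
    induction m with
    | zero => intro _; simp [detRatio_one hlam0]
    | succ m ih =>
      intro hm
      have h := ih (by omega)
      rw [Finset.sum_Icc_succ_top (by omega), detRatio_succ hlam0 x (t := m + 1) (by omega)]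
      have hw0 := inv_dotProduct_nonneg (design_posDef hlam0 x (m + 1)) (x (m + 1)).ofLp
      have hw1 : (x (m + 1)).ofLp ⬝ᵥ (design lam x (m + 1))⁻¹ *ᵥ (x (m + 1)).ofLp ≤ 1 := by
        refine (design_inv_dotProduct_le hlam0 x (m + 1) _).trans ?_
        rw [div_le_one hlam0]
        exact (pow_le_one₀ (norm_nonneg _)
          (hx _ (Finset.mem_Icc.2 ⟨by omega, hm⟩))).trans hlam
      rw [Real.log_mul (detRatio_pos hlam0 x _).ne' (by linarith), wnorm_sq hlam0]
      have := le_two_mul_log_one_add hw0 hw1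
      linarith
  have h1 := key n le_rfl
  have h2 := log_detRatio_le hd hlam0 x (t := n + 1) (by omega) (by
    intro k hk
    rw [Finset.mem_Ico] at hk
    exact hx k (Finset.mem_Icc.2 ⟨hk.1, by omega⟩))
  rw [Nat.cast_add, Nat.cast_one, add_sub_cancel_right] at h2
  linarith

/-- The weighted sum of the noise terms of rounds `1, …, t - 1`. -/
def noiseSum (x : ℕ → Vec d) (e : ℕ → ℝ) (t : ℕ) : Vec d := ∑ k ∈ Finset.Ico 1 t, e k • x k

/-- The weighted observations sum to `V θ` plus the noise sum minus `lam • θ`. The error is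
therefore a noise part and a regularization bias, each passed through `V⁻¹`. -/
lemma estimate_error (hlam : 0 < lam) (x : ℕ → Vec d) (θ : Vec d) (e : ℕ → ℝ) (t : ℕ) (v : Vec d) :
    inner ℝ (estimate lam x (fun k => inner ℝ θ (x k) + e k) t) v = inner ℝ θ v
      + (v.ofLp ⬝ᵥ (design lam x t)⁻¹ *ᵥ (noiseSum x e t).ofLp
        - lam * (v.ofLp ⬝ᵥ (design lam x t)⁻¹ *ᵥ θ.ofLp)) := by
  have hV := design_posDef hlam x t
  have hsum : (∑ k ∈ Finset.Ico 1 t, (inner ℝ θ (x k) + e k) • x k).ofLp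
      = design lam x t *ᵥ θ.ofLp + (noiseSum x e t).ofLp - lam • θ.ofLp := by
    rw [design, Matrix.add_mulVec, Matrix.smul_mulVec, Matrix.one_mulVec, Matrix.sum_mulVec]
    simp only [add_smul, Finset.sum_add_distrib, WithLp.ofLp_add, noiseSum]
    have : (∑ k ∈ Finset.Ico 1 t, inner ℝ θ (x k) • x k).ofLp
        = ∑ k ∈ Finset.Ico 1 t, Matrix.vecMulVec (x k).ofLp (x k).ofLp *ᵥ θ.ofLp := by
      rw [WithLp.ofLp_sum]
      refine Finset.sum_congr rfl fun k _ => ?_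
      rw [Matrix.vecMulVec_mulVec, WithLp.ofLp_smul, inner_eq_dotProduct, dotProduct_comm]
      simp
    rw [this]
    abel
  rw [inner_eq_dotProduct, estimate, hsum, Matrix.mulVec_sub, Matrix.mulVec_add,
    inv_mulVec_mulVec hV, Matrix.mulVec_smul, inner_eq_dotProduct]
  simp only [sub_dotProduct, add_dotProduct, smul_dotProduct, smul_eq_mul]
  rw [dotProduct_comm (_ *ᵥ _) v.ofLp, dotProduct_comm (_ *ᵥ _) v.ofLp]
  ring

/-- The confidence bound for the least-squares estimate. -/
lemma abs_estimate_sub_le (hlam : 0 < lam) (x : ℕ → Vec d) {θ : Vec d} (e : ℕ → ℝ) (t : ℕ)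
    {S r : ℝ} (hθ : ‖θ‖ ≤ S) (hr0 : 0 ≤ r)
    (hr : (noiseSum x e t).ofLp ⬝ᵥ (design lam x t)⁻¹ *ᵥ (noiseSum x e t).ofLp ≤ r ^ 2)
    (v : Vec d) :
    |inner ℝ (estimate lam x (fun k => inner ℝ θ (x k) + e k) t) v - inner ℝ θ v|
      ≤ (r + √lam * S) * wnorm (design lam x t)⁻¹ v := by
  have hV := design_posDef hlam x t
  rw [estimate_error hlam, add_sub_cancel_left]
  set W := wnorm (design lam x t)⁻¹ v with hW
  have hW0 : 0 ≤ W := wnorm_nonneg _ _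
  have hS0 : 0 ≤ S := (norm_nonneg θ).trans hθ
  have h1 : |v.ofLp ⬝ᵥ (design lam x t)⁻¹ *ᵥ (noiseSum x e t).ofLp| ≤ r * W := by
    refine abs_le_of_sq_le_sq ?_ (by positivity)
    refine (inv_dotProduct_sq_le hV _ _).trans ?_
    rw [← wnorm_sq hlam, ← hW, mul_pow, mul_comm]
    exact mul_le_mul_of_nonneg_right hr (sq_nonneg _)
  -- The bias costs only `√lam * S`: by Cauchy–Schwarz it is at most `lam` times the two weighted
  -- norms, and that of `θ` is at most `‖θ‖ / √lam`.
  have h2 : |lam * (v.ofLp ⬝ᵥ (design lam x t)⁻¹ *ᵥ θ.ofLp)| ≤ √lam * S * W := by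
    refine abs_le_of_sq_le_sq ?_ (by positivity)
    rw [mul_pow, mul_pow, mul_pow, Real.sq_sqrt hlam.le]
    calc lam ^ 2 * (v.ofLp ⬝ᵥ (design lam x t)⁻¹ *ᵥ θ.ofLp) ^ 2
        ≤ lam ^ 2 * (W ^ 2 * (‖θ‖ ^ 2 / lam)) := by
          refine mul_le_mul_of_nonneg_left ?_ (sq_nonneg _)
          refine (inv_dotProduct_sq_le hV _ _).trans ?_
          rw [← wnorm_sq hlam, ← hW]
          exact mul_le_mul_of_nonneg_left (design_inv_dotProduct_le hlam x t θ) (sq_nonneg _)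
      _ = lam * ‖θ‖ ^ 2 * W ^ 2 := by field_simp
      _ ≤ _ := by gcongr
  rw [abs_le] at h1 h2 ⊢
  constructor <;> linarith

end Design

/-! ### The abstract self-normalized tail bound -/

section SelfNormalized

variable {Ω : Type*} {m0 : MeasurableSpace Ω} {μ : Measure Ω} [IsProbabilityMeasure μ]

/-- The case `ρ = 0`, in which the Gaussian mixture is not defined. The function `e^η + e^(-η) - 2`
is nonnegative, vanishes only at `η = 0`, and has integral at most 0. -/
lemma ae_eq_zero_of_mgf_le_one {F : MeasurableSpace Ω} (hF : F ≤ m0) {η : Ω → ℝ}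
    (hint : ∀ s : ℝ, Integrable (fun ω => Real.exp (s * η ω)) μ)
    (hmgf : ∀ s : ℝ, μ[fun ω => Real.exp (s * η ω) | F] ≤ᵐ[μ] fun _ => 1) :
    η =ᵐ[μ] 0 := by
  have hle : ∀ s : ℝ, ∫ ω, Real.exp (s * η ω) ∂μ ≤ 1 := by
    intro s
    rw [← integral_condExp hF]
    refine (integral_mono_ae integrable_condExp (integrable_const 1) (hmgf s)).trans ?_
    simp
  set g : Ω → ℝ := fun ω => Real.exp (1 * η ω) + Real.exp (-1 * η ω) - 2 with hg
  have hg0 : ∀ ω, 0 ≤ g ω := fun ω => by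
    have h1 := Real.add_one_le_exp (1 * η ω)
    have h2 := Real.add_one_le_exp (-1 * η ω)
    simp only [hg]
    linarith
  have hgi : Integrable g μ := ((hint 1).add (hint (-1))).sub (integrable_const 2)
  have hgint : ∫ ω, g ω ∂μ = 0 := by
    refine le_antisymm ?_ (integral_nonneg hg0)
    have : ∫ ω, g ω ∂μ
        = ∫ ω, Real.exp (1 * η ω) ∂μ + ∫ ω, Real.exp (-1 * η ω) ∂μ - 2 := by
      have h := integral_sub ((hint 1).add (hint (-1))) (integrable_const (μ := μ) (2 : ℝ))
      rw [integral_add' (hint 1) (hint (-1)), integral_const, probReal_univ, one_smul] at h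
      exact h
    rw [this]
    linarith [hle 1, hle (-1)]
  filter_upwards [(integral_eq_zero_iff_of_nonneg hg0 hgi).1 hgint] with ω hω
  by_contra hne
  have h1 := Real.add_one_lt_exp (x := 1 * η ω) (by simpa using hne)
  have h2 := Real.add_one_lt_exp (x := -1 * η ω) (by simpa using hne)
  simp only [hg, Pi.zero_apply] at hω
  linarith

/-- The self-normalized tail bound, for a quadratic form `Q` and a determinant `p` that satisfy the
recursion of least-squares estimation. -/
lemma measure_exists_lt_quadratic_le {F : ℕ → MeasurableSpace Ω} (hF : ∀ t, F t ≤ m0)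
    (hmono : Monotone F) {ρ : ℝ} (hρ : 0 ≤ ρ) {N : ℕ} {e : ℕ → Ω → ℝ}
    (he : ∀ t, Measurable (e t))
    (hint : ∀ t ∈ Finset.Icc 1 N, ∀ s : ℝ, Integrable (fun ω => Real.exp (s * e t ω)) μ)
    (hmgf : ∀ t ∈ Finset.Icc 1 N, ∀ s : ℝ, μ[fun ω => Real.exp (s * e t ω) | F t]
      ≤ᵐ[μ] fun _ => Real.exp (s ^ 2 * ρ ^ 2 / 2))
    {Q p w m : ℕ → Ω → ℝ} (hQ : ∀ t, 1 ≤ t → Measurable[F t] (Q t))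
    (hp : ∀ t, 1 ≤ t → Measurable[F t] (p t)) (hw : ∀ t, 1 ≤ t → Measurable[F t] (w t))
    (hm : ∀ t, 1 ≤ t → Measurable[F t] (m t)) (hw0 : ∀ t ω, 0 ≤ w t ω) (hp0 : ∀ t ω, 0 < p t ω)
    (hQ1 : ∀ ω, Q 1 ω = 0) (hp1 : ∀ ω, p 1 ω = 1)
    (hQs : ∀ t, 1 ≤ t → ∀ ω, Q (t + 1) ω = Q t ω
      + (e t ω ^ 2 * w t ω + 2 * e t ω * m t ω - m t ω ^ 2) / (1 + w t ω))
    (hps : ∀ t, 1 ≤ t → ∀ ω, p (t + 1) ω = p t ω * (1 + w t ω))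
    {δ : ℝ} (hδ : 0 < δ) :
    μ {ω | ∃ t, 1 ≤ t ∧ t ≤ N + 1 ∧ ρ ^ 2 * (Real.log (p t ω) + 2 * Real.log (1 / δ)) < Q t ω}
      ≤ ENNReal.ofReal δ := by
  rcases hρ.eq_or_lt with rfl | hρ
  · have hz : ∀ᵐ ω ∂μ, ∀ t ∈ Finset.Icc 1 N, e t ω = 0 := by
      rw [Filter.eventually_all_finset]
      intro t ht
      exact ae_eq_zero_of_mgf_le_one (hF t) (hint t ht) (by simpa using hmgf t ht)
    have hnull : μ {ω | ∃ t, 1 ≤ t ∧ t ≤ N + 1 ∧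
        (0 : ℝ) ^ 2 * (Real.log (p t ω) + 2 * Real.log (1 / δ)) < Q t ω} = 0 := by
      refine measure_eq_zero_iff_ae_notMem.2 ?_
      filter_upwards [hz] with ω hω
      rintro ⟨t, ht1, htN, hlt⟩
      -- Without noise every increment of `Q` is nonpositive, so `Q` never exceeds its initial value
      -- 0.
      have : ∀ t, 1 ≤ t → t ≤ N + 1 → Q t ω ≤ 0 := by
        intro t ht
        induction t, ht using Nat.le_induction with
        | base => intro _; exact (hQ1 ω).le
        | succ t ht ih =>
          intro htN
          rw [hQs t ht, hω t (Finset.mem_Icc.2 ⟨ht, by omega⟩)]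
          have h1 := ih (by omega)
          have h2 : 0 ≤ m t ω ^ 2 / (1 + w t ω) :=
            div_nonneg (sq_nonneg _) (by linarith [hw0 t ω])
          have h3 : ((0 : ℝ) ^ 2 * w t ω + 2 * 0 * m t ω - m t ω ^ 2) / (1 + w t ω)
              = -(m t ω ^ 2 / (1 + w t ω)) := by ring
          linarith
      have := this t ht1 htN
      linarith
    rw [hnull]
    exact zero_le
  · set D : ℕ → Ω → ENNReal := fun t ω =>
      ENNReal.ofReal ((√(p t ω))⁻¹ * Real.exp (Q t ω / (2 * ρ ^ 2))) with hD
    have hDm : ∀ t, 1 ≤ t → Measurable[F t] (D t) := fun t ht =>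
      ((hp t ht).sqrt.inv.mul ((hQ t ht).div_const _).exp).ennreal_ofReal
    have hstep : ∀ t, 1 ≤ t → ∀ ω, D (t + 1) ω = D t ω * ENNReal.ofReal ((√(1 + w t ω))⁻¹ *
        Real.exp ((e t ω ^ 2 * w t ω + 2 * e t ω * m t ω - m t ω ^ 2)
          / (1 + w t ω) / (2 * ρ ^ 2))) := by
      intro t ht ω
      simp only [hD]
      rw [← ENNReal.ofReal_mul (by positivity), hps t ht, hQs t ht, Real.sqrt_mul (hp0 t ω).le,
        mul_inv, add_div, Real.exp_add]
      congr 1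
      ring
    -- The step from `t` to `t + 1` uses only the noise of round `t`, so `N` rounds of noise reach
    -- the index `N + 1`.
    have hsup : ∀ t, 1 ≤ t → t < N + 1 → ∀ A, MeasurableSet[F t] A →
        ∫⁻ ω in A, D (t + 1) ω ∂μ ≤ ∫⁻ ω in A, D t ω ∂μ := by
      intro t ht htN A hA
      rw [← lintegral_indicator (hF t _ hA), ← lintegral_indicator (hF t _ hA)]
      have htm : t ∈ Finset.Icc 1 N := Finset.mem_Icc.2 ⟨ht, by omega⟩
      refine le_trans (le_of_eq (lintegral_congr fun ω => ?_))
        (lintegral_mul_mixture_le (hF t) hρ (he t) (hint t htm) (hmgf t htm)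
          (G := A.indicator (D t)) ((hDm t ht).indicator hA) (hw t ht) (hw0 t) (hm t ht))
      by_cases hω : ω ∈ A
      · simp [hω, hstep t ht ω]
      · simp [hω]
    have h := measure_exists_ge_le hF hmono hDm hsup (ENNReal.ofReal (1 / δ)) (by omega)
    have hD1 : ∫⁻ ω, D 1 ω ∂μ = 1 := by simp [hD, hQ1, hp1]
    rw [hD1] at h
    have h2 : μ {ω | ∃ t, 1 ≤ t ∧ t ≤ N + 1 ∧ ENNReal.ofReal (1 / δ) ≤ D t ω}
        ≤ ENNReal.ofReal δ := by
      calc _ = ENNReal.ofReal δ * (ENNReal.ofReal (1 / δ)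
            * μ {ω | ∃ t, 1 ≤ t ∧ t ≤ N + 1 ∧ ENNReal.ofReal (1 / δ) ≤ D t ω}) := by
            rw [← mul_assoc, ← ENNReal.ofReal_mul hδ.le, mul_one_div_cancel hδ.ne',
              ENNReal.ofReal_one, one_mul]
        _ ≤ ENNReal.ofReal δ * 1 := mul_le_mul_right h _
        _ = _ := mul_one _
    refine (measure_mono ?_).trans h2
    rintro ω ⟨t, ht1, htN, hlt⟩
    refine ⟨t, ht1, htN, ENNReal.ofReal_le_ofReal ?_⟩
    have hpt := hp0 t ω
    -- The threshold is the inequality `D ≥ 1 / δ` solved for `Q`.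
    have hexp : √(p t ω) * (1 / δ) ≤ Real.exp (Q t ω / (2 * ρ ^ 2)) := by
      have : √(p t ω) * (1 / δ)
          = Real.exp ((Real.log (p t ω) + 2 * Real.log (1 / δ)) / 2) := by
        rw [add_div, Real.exp_add, mul_div_cancel_left₀ _ two_ne_zero,
          Real.exp_log (by positivity), Real.sqrt_eq_rpow, Real.rpow_def_of_pos hpt]
        ring_nf
      rw [this, Real.exp_le_exp, div_le_div_iff₀ two_pos (by positivity)]
      nlinarith
    rw [← div_eq_inv_mul, le_div_iff₀ (Real.sqrt_pos.2 hpt), mul_comm]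
    exact hexp

end SelfNormalized

/-! ### Measurability with respect to the history -/

section History

variable {d : ℕ} {Ω : Type*} {m0 : MeasurableSpace Ω} {x : ℕ → Ω → Vec d} {e : ℕ → Ω → ℝ}

lemma history_le (hx : ∀ t, Measurable (x t)) (he : ∀ t, Measurable (e t)) (t : ℕ) :
    history x e t ≤ m0 :=
  sup_le (iSup₂_le fun k _ => (hx k).comap_le) (iSup₂_le fun k _ => (he k).comap_le)

omit m0 in
lemma history_mono (x : ℕ → Ω → Vec d) (e : ℕ → Ω → ℝ) : Monotone (history x e) := by
  intro s t hst
  refine sup_le_sup (iSup₂_le fun k hk => ?_) (iSup₂_le fun k hk => ?_)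
  · rw [Finset.mem_Icc] at hk
    exact le_iSup₂_of_le k (Finset.mem_Icc.2 ⟨hk.1, hk.2.trans hst⟩) le_rfl
  · rw [Finset.mem_Ico] at hk
    exact le_iSup₂_of_le k (Finset.mem_Ico.2 ⟨hk.1, hk.2.trans_le hst⟩) le_rfl

omit m0 in
lemma measurable_action_history (x : ℕ → Ω → Vec d) (e : ℕ → Ω → ℝ) {k t : ℕ} (h1 : 1 ≤ k)
    (hk : k ≤ t) : Measurable[history x e t] (x k) := by
  refine measurable_iff_comap_le.2 (le_sup_of_le_left ?_)
  exact le_iSup₂_of_le (f := fun k _ => MeasurableSpace.comap (x k) inferInstance) k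
    (Finset.mem_Icc.2 ⟨h1, hk⟩) le_rfl

omit m0 in
lemma measurable_noise_history (x : ℕ → Ω → Vec d) (e : ℕ → Ω → ℝ) {k t : ℕ} (h1 : 1 ≤ k)
    (hk : k < t) : Measurable[history x e t] (e k) := by
  refine measurable_iff_comap_le.2 (le_sup_of_le_right ?_)
  exact le_iSup₂_of_le (f := fun k _ => MeasurableSpace.comap (e k) inferInstance) k
    (Finset.mem_Ico.2 ⟨h1, hk⟩) le_rfl

end History

/-! ### Measurability of determinants, inverses and quadratic forms -/

section MatrixMeasurability

variable {Ω ι : Type*} {F : MeasurableSpace Ω} [Fintype ι] [DecidableEq ι]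

lemma measurable_det {M : Ω → Matrix ι ι ℝ} (hM : ∀ i j, Measurable fun ω => M ω i j) :
    Measurable fun ω => (M ω).det := by
  simp only [Matrix.det_apply]
  exact Finset.measurable_fun_sum _ fun σ _ =>
    (Finset.measurable_fun_prod _ fun i _ => hM _ _).const_smul _

lemma measurable_inv_apply {M : Ω → Matrix ι ι ℝ} (hM : ∀ i j, Measurable fun ω => M ω i j)
    (i j : ι) : Measurable fun ω => (M ω)⁻¹ i j := by
  simp only [Matrix.inv_def, Matrix.smul_apply, Ring.inverse_eq_inv', smul_eq_mul,
    Matrix.adjugate_apply]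
  refine (measurable_det hM).inv.mul (measurable_det fun a b => ?_)
  by_cases h : a = j
  · subst h
    simp
  · simpa [Matrix.updateRow_ne h] using hM a b

omit [DecidableEq ι] in
lemma measurable_dotProduct_mulVec {M : Ω → Matrix ι ι ℝ} {u v : Ω → ι → ℝ}
    (hM : ∀ i j, Measurable fun ω => M ω i j) (hu : ∀ i, Measurable fun ω => u ω i)
    (hv : ∀ i, Measurable fun ω => v ω i) : Measurable fun ω => u ω ⬝ᵥ M ω *ᵥ v ω := by
  simp only [dotProduct, Matrix.mulVec]
  exact Finset.measurable_fun_sum _ fun i _ => (hu i).mul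
    (Finset.measurable_fun_sum _ fun j _ => (hM i j).mul (hv j))

end MatrixMeasurability

/-! ### Tail bounds for vector and scalar least squares -/

section Confidence

variable {d : ℕ} {Ω : Type*} {m0 : MeasurableSpace Ω} {μ : Measure Ω} [IsProbabilityMeasure μ]
  {x : ℕ → Ω → Vec d} {e : ℕ → Ω → ℝ}

/-- The abstract bound applies because the history of round `t` contains the action of that round
but not its noise: the design, the noise sum and the leverage of the new action are all known before
the noise is drawn. -/
lemma measure_exists_lt_noiseSum_le (hx : ∀ t, Measurable (x t)) (he : ∀ t, Measurable (e t))
    {ρ lam δ : ℝ} (hρ : 0 ≤ ρ) (hlam : 0 < lam) (hδ : 0 < δ) {N : ℕ}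
    (hn : SubgaussianNoise μ ρ N x e) :
    μ {ω | ∃ t, 1 ≤ t ∧ t ≤ N + 1 ∧
        ρ ^ 2 * (Real.log (detRatio lam (x · ω) t) + 2 * Real.log (1 / δ))
          < (noiseSum (x · ω) (e · ω) t).ofLp ⬝ᵥ (design lam (x · ω) t)⁻¹ *ᵥ
            (noiseSum (x · ω) (e · ω) t).ofLp}
      ≤ ENNReal.ofReal δ := by
  have hcoord : ∀ {k t : ℕ}, 1 ≤ k → k ≤ t → ∀ i, Measurable[history x e t] fun ω => x k ω i :=
    fun h1 hk i => (EuclideanSpace.proj (𝕜 := ℝ) i).continuous.measurable.comp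
      (measurable_action_history x e h1 hk)
  have hdes : ∀ t i j, Measurable[history x e t] fun ω => design lam (x · ω) t i j := by
    intro t i j
    simp only [design, Matrix.add_apply, Matrix.sum_apply, Matrix.vecMulVec_apply]
    refine (Finset.measurable_fun_sum _ fun k hk => ?_).add_const _
    rw [Finset.mem_Ico] at hk
    exact (hcoord hk.1 hk.2.le i).mul (hcoord hk.1 hk.2.le j)
  have hinv : ∀ t i j, Measurable[history x e t] fun ω => (design lam (x · ω) t)⁻¹ i j :=
    fun t => measurable_inv_apply (hdes t)
  have hns : ∀ t i, Measurable[history x e t] fun ω => noiseSum (x · ω) (e · ω) t i := by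
    intro t i
    simp only [noiseSum, WithLp.ofLp_sum, WithLp.ofLp_smul, Finset.sum_apply, Pi.smul_apply,
      smul_eq_mul]
    refine Finset.measurable_fun_sum _ fun k hk => ?_
    rw [Finset.mem_Ico] at hk
    exact (measurable_noise_history x e hk.1 hk.2).mul (hcoord hk.1 hk.2.le i)
  refine measure_exists_lt_quadratic_le (F := history x e) (history_le hx he) (history_mono x e)
    hρ he hn.integrable_exp hn.mgf
    (Q := fun t ω => (noiseSum (x · ω) (e · ω) t).ofLp ⬝ᵥ (design lam (x · ω) t)⁻¹ *ᵥ
            (noiseSum (x · ω) (e · ω) t).ofLp)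
    (p := fun t ω => detRatio lam (x · ω) t)
    (w := fun t ω => (x t ω).ofLp ⬝ᵥ (design lam (x · ω) t)⁻¹ *ᵥ (x t ω).ofLp)
    (m := fun t ω => (x t ω).ofLp ⬝ᵥ (design lam (x · ω) t)⁻¹ *ᵥ
      (noiseSum (x · ω) (e · ω) t).ofLp)
    ?_ ?_ ?_ ?_ ?_ ?_ ?_ ?_ ?_ ?_ hδ
  · exact fun t _ => measurable_dotProduct_mulVec (hinv t) (hns t) (hns t)
  · exact fun t _ => (measurable_det (hdes t)).div_const _
  · exact fun t ht => measurable_dotProduct_mulVec (hinv t) (hcoord ht le_rfl) (hcoord ht le_rfl)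
  · exact fun t ht => measurable_dotProduct_mulVec (hinv t) (hcoord ht le_rfl) (hns t)
  · exact fun t ω => inv_dotProduct_nonneg (design_posDef hlam _ t) _
  · exact fun t ω => detRatio_pos hlam _ t
  · exact fun ω => by simp [noiseSum]
  · exact fun ω => detRatio_one hlam _
  · intro t ht ω
    have h := inv_add_vecMulVec_dotProduct (design_posDef hlam (x · ω) t) (x t ω).ofLp
      (noiseSum (x · ω) (e · ω) t).ofLp (e t ω)
    rw [← design_succ lam (x · ω) ht] at h
    rw [← h, noiseSum, Finset.sum_Ico_succ_top ht]
    rfl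
  · exact fun t ht ω => detRatio_succ hlam (x · ω) ht

/-- The self-normalized tail bound for scalar weights. -/
lemma measure_exists_lt_weighted_le (hx : ∀ t, Measurable (x t)) (he : ∀ t, Measurable (e t))
    {ρ lam δ : ℝ} (hρ : 0 ≤ ρ) (hlam : 0 < lam) (hδ : 0 < δ) {N : ℕ}
    (hn : SubgaussianNoise μ ρ N x e) {ξ : ℕ → Ω → ℝ}
    (hξ : ∀ t, 1 ≤ t → Measurable[history x e t] (ξ t)) :
    μ {ω | ∃ t, 1 ≤ t ∧ t ≤ N + 1 ∧
        ρ ^ 2 * (Real.log ((lam + ∑ k ∈ Finset.Ico 1 t, ξ k ω ^ 2) / lam) + 2 * Real.log (1 / δ))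
          < (∑ k ∈ Finset.Ico 1 t, e k ω * ξ k ω) ^ 2
            / (lam + ∑ k ∈ Finset.Ico 1 t, ξ k ω ^ 2)}
      ≤ ENNReal.ofReal δ := by
  set v : ℕ → Ω → ℝ := fun t ω => lam + ∑ k ∈ Finset.Ico 1 t, ξ k ω ^ 2 with hv
  set s : ℕ → Ω → ℝ := fun t ω => ∑ k ∈ Finset.Ico 1 t, e k ω * ξ k ω with hs
  have hv0 : ∀ t ω, 0 < v t ω := fun t ω => by positivity
  have hξ' : ∀ {k t : ℕ}, 1 ≤ k → k ≤ t → Measurable[history x e t] (ξ k) :=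
    fun h1 hk => (hξ _ h1).mono (history_mono x e hk) le_rfl
  have hvm : ∀ t, Measurable[history x e t] (v t) := by
    intro t
    refine (Finset.measurable_fun_sum _ fun k hk => ?_).const_add _
    rw [Finset.mem_Ico] at hk
    exact (hξ' hk.1 hk.2.le).pow_const 2
  have hsm : ∀ t, Measurable[history x e t] (s t) := by
    intro t
    refine Finset.measurable_fun_sum _ fun k hk => ?_
    rw [Finset.mem_Ico] at hk
    exact (measurable_noise_history x e hk.1 hk.2).mul (hξ' hk.1 hk.2.le)
  have hvs : ∀ t, 1 ≤ t → ∀ ω, v (t + 1) ω = v t ω + ξ t ω ^ 2 := fun t ht ω => by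
    simp only [hv]
    rw [Finset.sum_Ico_succ_top ht, add_assoc]
  refine measure_exists_lt_quadratic_le (F := history x e) (history_le hx he) (history_mono x e)
    hρ he hn.integrable_exp hn.mgf (Q := fun t ω => s t ω ^ 2 / v t ω)
    (p := fun t ω => v t ω / lam) (w := fun t ω => ξ t ω ^ 2 / v t ω)
    (m := fun t ω => ξ t ω * s t ω / v t ω)
    ?_ ?_ ?_ ?_ ?_ ?_ ?_ ?_ ?_ ?_ hδ
  · exact fun t _ => ((hsm t).pow_const 2).div (hvm t)
  · exact fun t _ => (hvm t).div_const _
  · exact fun t ht => ((hξ t ht).pow_const 2).div (hvm t)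
  · exact fun t ht => ((hξ t ht).mul (hsm t)).div (hvm t)
  · exact fun t ω => div_nonneg (sq_nonneg _) (hv0 t ω).le
  · exact fun t ω => div_pos (hv0 t ω) hlam
  · exact fun ω => by simp [hs]
  · exact fun ω => by simp [hv, hlam.ne']
  · intro t ht ω
    have h1 := hv0 t ω
    have h2 : s (t + 1) ω = s t ω + e t ω * ξ t ω := Finset.sum_Ico_succ_top ht _
    have h3 : v t ω + ξ t ω ^ 2 ≠ 0 := by positivity
    simp only [hvs t ht, h2]
    field_simp
    ring
  · intro t ht ω
    have h1 := hv0 t ω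
    simp only [hvs t ht]
    field_simp

end Confidence

/-! ### Elementary properties of the confidence radius -/

section ConfidenceRadius

variable {P : Params}

lemma Params.Valid.lam_pos (hP : P.Valid) : 0 < P.lam := one_pos.trans_le hP.lam_ge

lemma Params.Valid.b_le_S (hP : P.Valid) : P.b ≤ P.S :=
  ((div_le_one hP.Sa_pos).1 hP.b_le).trans (le_max_left _ _)

lemma Params.Valid.S_pos (hP : P.Valid) : 0 < P.S := hP.Sa_pos.trans_le (le_max_left _ _)

lemma Params.Valid.one_le_S_div (hP : P.Valid) : 1 ≤ P.S / P.b :=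
  (one_le_div hP.b_pos).2 hP.b_le_S

lemma Params.Valid.one_le_arg (hP : P.Valid) {t : ℝ} (ht : 1 ≤ t) : 1 ≤ 1 + (t - 1) / P.lam := by
  have := div_nonneg (sub_nonneg.2 ht) hP.lam_pos.le
  linarith

lemma Params.Valid.log_two_div_pos (hP : P.Valid) : 0 < Real.log (2 / P.δ) := by
  refine Real.log_pos ((one_lt_div hP.δ_pos).2 ?_)
  linarith [hP.δ_lt]

lemma Params.Valid.log_arg_eq (hP : P.Valid) {t : ℝ} (ht : 1 ≤ t) :
    Real.log ((1 + (t - 1) / P.lam) / (P.δ / 2))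
      = Real.log (1 + (t - 1) / P.lam) + Real.log (2 / P.δ) := by
  have h := hP.one_le_arg ht
  have hδ := hP.δ_pos
  rw [← Real.log_mul (by linarith) (by positivity)]
  congr 1
  field_simp

lemma Params.Valid.log_arg_pos (hP : P.Valid) {t : ℝ} (ht : 1 ≤ t) :
    0 < Real.log ((1 + (t - 1) / P.lam) / (P.δ / 2)) := by
  rw [hP.log_arg_eq ht]
  exact add_pos_of_nonneg_of_pos (Real.log_nonneg (hP.one_le_arg ht)) hP.log_two_div_pos

lemma Params.Valid.log_arg_mono (hP : P.Valid) {s t : ℝ} (hs : 1 ≤ s) (hst : s ≤ t) :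
    Real.log ((1 + (s - 1) / P.lam) / (P.δ / 2))
      ≤ Real.log ((1 + (t - 1) / P.lam) / (P.δ / 2)) := by
  rw [hP.log_arg_eq hs, hP.log_arg_eq (hs.trans hst)]
  have h1 := hP.one_le_arg hs
  have h2 : (s - 1) / P.lam ≤ (t - 1) / P.lam :=
    div_le_div_of_nonneg_right (by linarith) hP.lam_pos.le
  have := Real.log_le_log (by linarith) (by linarith : 1 + (s - 1) / P.lam ≤ 1 + (t - 1) / P.lam)
  linarith

lemma Params.Valid.β_mono (hP : P.Valid) (d : ℕ) {s t : ℝ} (hs : 1 ≤ s) (hst : s ≤ t) :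
    P.β d s ≤ P.β d t := by
  have h := hP.log_arg_mono hs hst
  have := hP.ρ_nonneg
  unfold Params.β
  gcongr

lemma Params.Valid.le_β (hP : P.Valid) (d : ℕ) (t : ℝ) : √P.lam * P.S ≤ P.β d t :=
  le_add_of_nonneg_left (mul_nonneg hP.ρ_nonneg (Real.sqrt_nonneg _))

lemma Params.Valid.β_pos (hP : P.Valid) (d : ℕ) (t : ℝ) : 0 < P.β d t :=
  (mul_pos (Real.sqrt_pos.2 hP.lam_pos) hP.S_pos).trans_le (hP.le_β d t)

end ConfidenceRadius

/-! ### Regret and wrong directions of OPLB on the confidence event -/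

section OPLB

variable {d : ℕ} {P : Params} {E : Env d}

/-- The confidence set for the parameter `θ` is valid in round `t`. -/
def Confident (P : Params) (x : ℕ → Vec d) (θ : Vec d) (e : ℕ → ℝ) (t : ℕ) : Prop :=
  ∀ v, |inner ℝ (estimate P.lam x (fun k => inner ℝ θ (x k) + e k) t) v - inner ℝ θ v|
    ≤ P.β d t * wnorm (design P.lam x t)⁻¹ v

/-- The radius puts the factor `d` in front of the whole logarithm, while the tail bound yields `d`
times the growth term plus `2 log (2 / δ)`. The latter is at most `d log (2 / δ)` because `d ≥ 2`.
-/
lemma confident_of_quadratic_le (hP : P.Valid) (hd : 2 ≤ d) {x : ℕ → Vec d} {θ : Vec d}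
    {e : ℕ → ℝ} {t : ℕ} (ht : 1 ≤ t) (hθ : ‖θ‖ ≤ P.S) (hx : ∀ k ∈ Finset.Ico 1 t, ‖x k‖ ≤ 1)
    (hq : (noiseSum x e t).ofLp ⬝ᵥ (design P.lam x t)⁻¹ *ᵥ (noiseSum x e t).ofLp
      ≤ P.ρ ^ 2 * (Real.log (detRatio P.lam x t) + 2 * Real.log (1 / (P.δ / 2)))) :
    Confident P x θ e t := by
  have ht' : (1 : ℝ) ≤ t := by exact_mod_cast ht
  have hd' : (2 : ℝ) ≤ d := by exact_mod_cast hd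
  have hl := hP.log_arg_pos ht'
  refine abs_estimate_sub_le hP.lam_pos x e t hθ
    (mul_nonneg hP.ρ_nonneg (Real.sqrt_nonneg _)) (hq.trans ?_)
  rw [mul_pow, Real.sq_sqrt (by positivity)]
  refine mul_le_mul_of_nonneg_left ?_ (sq_nonneg _)
  have h1 := log_detRatio_le (by omega) hP.lam_pos x ht hx
  have h0 : 0 ≤ ((t : ℝ) - 1) := by linarith
  have hlam := hP.lam_pos
  have h2 : Real.log (1 + (t - 1) / (P.lam * d)) ≤ Real.log (1 + (t - 1) / P.lam) := by
    refine Real.log_le_log (by positivity) ?_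
    gcongr
    exact le_mul_of_one_le_right hlam.le (by linarith)
  rw [hP.log_arg_eq ht', show (1 / (P.δ / 2)) = 2 / P.δ by rw [one_div_div]]
  have h3 := hP.log_two_div_pos
  nlinarith

lemma Env.Valid.zero_mem (hE : E.Valid P) (hP : P.Valid) : (0 : Vec d) ∈ E.feasible P.b := by
  refine ⟨?_, by simpa using hP.b_pos.le⟩
  have h := hE.star hE.xstar_mem.1 (a := 1) (b := 0) (by norm_num) le_rfl (by norm_num)
  simpa using h

lemma Env.Valid.smul_mem (hE : E.Valid P) {v : Vec d} (hv : v ∈ E.X) {c : ℝ} (h0 : 0 ≤ c)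
    (h1 : c ≤ 1) : c • v ∈ E.X := by
  simpa using hE.star hv (a := 1 - c) (b := c) (by linarith) h0 (by ring)

lemma Env.Valid.regret_nonneg (hE : E.Valid P) {v : Vec d} (hv : v ∈ E.feasible P.b) :
    0 ≤ inner ℝ E.θ (E.xstar - v) := by
  rw [inner_sub_right]
  exact sub_nonneg.2 (hE.xstar_max hv)

lemma Env.Valid.gap_le (hE : E.Valid P) {v : Vec d} (hv : v ∈ E.feasible P.b)
    (hdir : ¬ SameDir v E.xstar) : E.gap P.b ≤ inner ℝ E.θ (E.xstar - v) := by
  refine csInf_le ⟨0, ?_⟩ ⟨v, ⟨hv, hdir⟩, rfl⟩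
  rintro _ ⟨u, hu, rfl⟩
  exact hE.regret_nonneg hu.1

lemma Env.Valid.xstar_ne_zero (hE : E.Valid P) : E.xstar ≠ 0 := by
  intro h
  have := hE.reward_pos
  simp [h] at this

lemma Env.Valid.reward_le (hE : E.Valid P) : inner ℝ E.θ E.xstar ≤ P.Sθ := by
  have h1 := hE.norm_le _ hE.xstar_mem.1
  have h2 := real_inner_le_norm E.θ E.xstar
  have h3 := hE.norm_θ_le
  nlinarith [norm_nonneg E.θ, norm_nonneg E.xstar]

/-- The origin is feasible and is not a positive multiple of the optimal action, so it competes in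
the infimum. -/
lemma Env.Valid.gap_le_reward (hE : E.Valid P) (hP : P.Valid) :
    E.gap P.b ≤ inner ℝ E.θ E.xstar := by
  have h := hE.gap_le (hE.zero_mem hP) (by
    rintro ⟨α, hα, h⟩
    exact (smul_ne_zero hα.ne' hE.xstar_ne_zero) h.symm)
  simpa using h

lemma Env.Valid.gap_le_S (hE : E.Valid P) (hP : P.Valid) : E.gap P.b ≤ P.S :=
  ((hE.gap_le_reward hP).trans hE.reward_le).trans (le_max_right _ _)

lemma OPLBStep.mem_feasible {x : ℕ → Vec d} {y η : ℕ → ℝ} {t : ℕ}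
    (h : OPLBStep P E.X x y (fun k => inner ℝ E.a (x k) + η k) t) (ha : Confident P x E.a η t) :
    x t ∈ E.feasible P.b := by
  refine ⟨h.1.1, ?_⟩
  have h1 := h.1.2
  have h2 := (abs_le.1 (ha (x t))).1
  linarith

/-- The regret of an optimistic action, on the confidence event. -/
lemma OPLBStep.regret_le (hP : P.Valid) (hE : E.Valid P) {x : ℕ → Vec d} {ε η : ℕ → ℝ} {t : ℕ}
    (h : OPLBStep P E.X x (fun k => inner ℝ E.θ (x k) + ε k)
      (fun k => inner ℝ E.a (x k) + η k) t)
    (hθ : Confident P x E.θ ε t) (ha : Confident P x E.a η t) :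
    inner ℝ E.θ (E.xstar - x t)
      ≤ 2 * (1 + P.S / P.b) * P.β d t * wnorm (design P.lam x t)⁻¹ (x t) := by
  have hb := hP.b_pos
  have hβ := hP.β_pos d t
  set M := (design P.lam x t)⁻¹ with hM
  set c := P.β d t * wnorm M E.xstar with hc
  have hc0 : 0 ≤ c := mul_nonneg hβ.le (wnorm_nonneg _ _)
  -- The pessimistic constraint value of the optimal action is at most `b + 2c`: one `c` is the
  -- estimation error, the other the width. Scaling by `α` brings it down to `b`.
  set α := P.b / (P.b + 2 * c) with hα
  have hα0 : 0 < α := by positivity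
  have hα1 : α ≤ 1 := (div_le_one (by positivity)).2 (by linarith)
  have hαe : α * (P.b + 2 * c) = P.b := by rw [hα]; field_simp
  have hmem : α • E.xstar ∈ pess P E.X x (fun k => inner ℝ E.a (x k) + η k) t := by
    refine ⟨hE.smul_mem hE.xstar_mem.1 hα0.le hα1, ?_⟩
    have h1 := (abs_le.1 (ha E.xstar)).2
    have h2 := hE.xstar_mem.2
    rw [inner_smul_right, wnorm_smul _ hα0.le]
    calc _ = α * (inner ℝ (estimate P.lam x (fun k => inner ℝ E.a (x k) + η k) t) E.xstar
          + c) := by rw [hc]; ring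
      _ ≤ α * (P.b + 2 * c) := by
          refine mul_le_mul_of_nonneg_left ?_ hα0.le
          linarith
      _ = P.b := hαe
  have hmax : ucb P x (fun k => inner ℝ E.θ (x k) + ε k) t (α • E.xstar)
      ≤ ucb P x (fun k => inner ℝ E.θ (x k) + ε k) t (x t) := h.2 hmem
  simp only [ucb] at hmax
  rw [inner_smul_right, wnorm_smul _ hα0.le] at hmax
  have hκ : P.κ = 1 + 2 * P.Sθ / P.b := rfl
  have h3 := (abs_le.1 (hθ E.xstar)).1
  have h4 := (abs_le.1 (hθ (x t))).2
  have h5 := hE.reward_le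
  -- Undoing the scaling adds the fraction `2c / b` of a reward that is at most `Sθ`, that is at
  -- most `(κ - 1) c`. This is the reason for the value of `κ`.
  have hlow : inner ℝ E.θ E.xstar ≤ α * (inner ℝ E.θ E.xstar + (P.κ - 1) * c) := by
    have : inner ℝ E.θ E.xstar = α * (inner ℝ E.θ E.xstar * (P.b + 2 * c) / P.b) := by
      rw [mul_div_assoc', ← mul_assoc, mul_comm α, mul_assoc, hαe]
      field_simp
    rw [this]
    refine mul_le_mul_of_nonneg_left ?_ hα0.le
    rw [← this, hκ, div_le_iff₀ hb]
    have : (inner ℝ E.θ E.xstar + (1 + 2 * P.Sθ / P.b - 1) * c) * P.b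
        = inner ℝ E.θ E.xstar * P.b + 2 * P.Sθ * c := by field_simp; ring
    rw [this]
    nlinarith
  have hmid : α * (inner ℝ E.θ E.xstar + (P.κ - 1) * c)
      ≤ α * inner ℝ (estimate P.lam x (fun k => inner ℝ E.θ (x k) + ε k) t) E.xstar
        + P.κ * P.β d t * (α * wnorm M E.xstar) := by
    have : α * inner ℝ (estimate P.lam x (fun k => inner ℝ E.θ (x k) + ε k) t) E.xstar
        + P.κ * P.β d t * (α * wnorm M E.xstar)
        = α * (inner ℝ (estimate P.lam x (fun k => inner ℝ E.θ (x k) + ε k) t) E.xstar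
          + P.κ * c) := by rw [hc]; ring
    rw [this]
    refine mul_le_mul_of_nonneg_left ?_ hα0.le
    linarith
  have hfin : inner ℝ E.θ (E.xstar - x t) ≤ (P.κ + 1) * (P.β d t * wnorm M (x t)) := by
    rw [inner_sub_right]
    linarith
  refine hfin.trans ?_
  rw [mul_assoc (2 * (1 + P.S / P.b))]
  refine mul_le_mul_of_nonneg_right ?_ (mul_nonneg hβ.le (wnorm_nonneg _ _))
  have : P.Sθ / P.b ≤ P.S / P.b := div_le_div_of_nonneg_right (le_max_right _ _) hb.le
  rw [hκ, mul_div_assoc]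
  linarith

/-- In the rounds `1, …, n` OPLB is played, with valid confidence sets. -/
structure GoodOPLB (P : Params) (E : Env d) (x : ℕ → Vec d) (ε η : ℕ → ℝ) (n : ℕ) : Prop where
  step : ∀ t ∈ Finset.Icc 1 n, OPLBStep P E.X x (fun k => inner ℝ E.θ (x k) + ε k)
    (fun k => inner ℝ E.a (x k) + η k) t
  conf_θ : ∀ t ∈ Finset.Icc 1 n, Confident P x E.θ ε t
  conf_a : ∀ t ∈ Finset.Icc 1 n, Confident P x E.a η t

variable {x : ℕ → Vec d} {ε η : ℕ → ℝ} {n : ℕ}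

lemma GoodOPLB.mem_feasible (h : GoodOPLB P E x ε η n) {t : ℕ} (ht : t ∈ Finset.Icc 1 n) :
    x t ∈ E.feasible P.b :=
  (h.step t ht).mem_feasible (h.conf_a t ht)

lemma GoodOPLB.sum_sq_le (hP : P.Valid) (hE : E.Valid P) (hd : 1 ≤ d)
    (h : GoodOPLB P E x ε η n) :
    ∑ t ∈ Finset.Icc 1 n, (inner ℝ E.θ (E.xstar - x t)) ^ 2
      ≤ 8 * d * (1 + P.S / P.b) ^ 2 * P.β d n ^ 2 * Real.log (1 + n / (P.lam * d)) := by
  have hs := hP.one_le_S_div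
  have hpot := sum_wnorm_sq_le hd hP.lam_ge x (n := n)
    fun k hk => hE.norm_le _ (h.mem_feasible hk).1
  calc _ ≤ ∑ t ∈ Finset.Icc 1 n, (2 * (1 + P.S / P.b) * P.β d n) ^ 2
        * wnorm (design P.lam x t)⁻¹ (x t) ^ 2 := by
        refine Finset.sum_le_sum fun t ht => ?_
        rw [← mul_pow]
        refine pow_le_pow_left₀ (hE.regret_nonneg (h.mem_feasible ht)) ?_ 2
        refine ((h.step t ht).regret_le hP hE (h.conf_θ t ht) (h.conf_a t ht)).trans ?_
        rw [Finset.mem_Icc] at ht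
        have := hP.β_mono d (s := t) (t := n) (by exact_mod_cast ht.1) (by exact_mod_cast ht.2)
        have := wnorm_nonneg (design P.lam x t)⁻¹ (x t)
        gcongr
    _ ≤ (2 * (1 + P.S / P.b) * P.β d n) ^ 2 * (2 * (d * Real.log (1 + n / (P.lam * d)))) := by
        rw [← Finset.mul_sum]
        exact mul_le_mul_of_nonneg_left hpot (sq_nonneg _)
    _ = _ := by ring

/-- Every wrong round plays a feasible action and so contributes at least the squared gap to the sum
of squared costs. -/
lemma GoodOPLB.wrongCount_le (hP : P.Valid) (hE : E.Valid P) (hd : 1 ≤ d) (hgap : 0 < E.gap P.b)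
    (h : GoodOPLB P E x ε η n) :
    (E.wrongCount x n : ℝ) ≤ 8 * d * (1 + P.S / P.b) ^ 2 * P.β d n ^ 2
      * Real.log (1 + n / (P.lam * d)) / E.gap P.b ^ 2 := by
  classical
  rw [le_div_iff₀ (by positivity)]
  refine le_trans ?_ (h.sum_sq_le hP hE hd)
  unfold Env.wrongCount
  rw [← nsmul_eq_mul, ← Finset.sum_const]
  refine le_trans (Finset.sum_le_sum fun t ht => ?_)
    (Finset.sum_le_sum_of_subset_of_nonneg (Finset.filter_subset _ _) fun t _ _ => sq_nonneg _)
  rw [Finset.mem_filter] at ht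
  exact pow_le_pow_left₀ hgap.le (hE.gap_le (h.mem_feasible ht.1) ht.2) 2

lemma GoodOPLB.regret_le (hP : P.Valid) (hE : E.Valid P) (hd : 1 ≤ d)
    (h : GoodOPLB P E x ε η n) :
    E.regret x n ≤ 2 * (1 + P.S / P.b) * P.β d n
      * √(2 * d * n * Real.log (1 + n / (P.lam * d))) := by
  have hs := hP.one_le_S_div
  have hβ := hP.β_pos d n
  have hlam := hP.lam_pos
  have hlog : 0 ≤ Real.log (1 + n / (P.lam * d)) :=
    Real.log_nonneg (le_add_of_nonneg_right (by positivity))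
  have h1 := sq_sum_le_card_mul_sum_sq (s := Finset.Icc 1 n)
    (f := fun t => (inner ℝ E.θ (E.xstar - x t) : ℝ))
  rw [Nat.card_Icc, Nat.add_sub_cancel] at h1
  refine abs_le_of_sq_le_sq' (h1.trans ?_) (by positivity) |>.2
  rw [mul_pow, Real.sq_sqrt (by positivity)]
  refine (mul_le_mul_of_nonneg_left (h.sum_sq_le hP hE hd) (Nat.cast_nonneg n)).trans_eq ?_
  ring

end OPLB

/-! ### Telescoping bounds for scalar potentials -/

section Potential

/-- With `p` and `q` the roots of the design before and after a round, the increment is at most `2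
(q - p) + 1/p - 1/q`. The telescoping correction `1/p - 1/q` pays for dividing by the older design,
since `q (q - p) ≤ q² - p² ≤ 1`. -/
lemma sum_sq_div_sqrt_le {lam : ℝ} (hlam : 1 ≤ lam) {ζ : ℕ → ℝ} (a : ℕ) {b : ℕ} (hab : a ≤ b)
    (hζ : ∀ t ∈ Finset.Ico a b, ζ t ^ 2 ≤ 1) :
    ∑ t ∈ Finset.Ico a b, ζ t ^ 2 / √(lam + ∑ s ∈ Finset.Ico a t, ζ s ^ 2)
      ≤ 2 * √(lam + ∑ s ∈ Finset.Ico a b, ζ s ^ 2) - 2 * √lam + 1 / √lam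
        - 1 / √(lam + ∑ s ∈ Finset.Ico a b, ζ s ^ 2) := by
  induction b, hab using Nat.le_induction with
  | base => simp
  | succ b hab ih =>
    have hih := ih fun t ht => hζ t (Finset.Ico_subset_Ico_right (Nat.le_succ b) ht)
    have hb := hζ b (Finset.mem_Ico.2 ⟨hab, Nat.lt_succ_self b⟩)
    have hsum : ∑ s ∈ Finset.Ico a (b + 1), ζ s ^ 2
        = ∑ s ∈ Finset.Ico a b, ζ s ^ 2 + ζ b ^ 2 := Finset.sum_Ico_succ_top hab _
    rw [Finset.sum_Ico_succ_top hab, hsum]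
    set v := lam + ∑ s ∈ Finset.Ico a b, ζ s ^ 2 with hv
    have hv0 : 0 < v := by positivity
    rw [← add_assoc, ← hv]
    have hp : 0 < √v := Real.sqrt_pos.2 hv0
    have hpq : √v ≤ √(v + ζ b ^ 2) := Real.sqrt_le_sqrt (by linarith [sq_nonneg (ζ b)])
    have hp2 : √v ^ 2 = v := Real.sq_sqrt hv0.le
    have hq2 : √(v + ζ b ^ 2) ^ 2 = v + ζ b ^ 2 := Real.sq_sqrt (by positivity)
    set p := √v
    set q := √(v + ζ b ^ 2)
    have hq : 0 < q := hp.trans_le hpq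
    have hz : ζ b ^ 2 = q ^ 2 - p ^ 2 := by linarith
    have hstep : ζ b ^ 2 / p ≤ 2 * q - 2 * p + 1 / p - 1 / q := by
      have hid : 2 * q - 2 * p + 1 / p - 1 / q - ζ b ^ 2 / p
          = (q - p) * (1 - q * (q - p)) / (p * q) := by
        rw [hz]
        field_simp
        ring
      have h1 : 0 ≤ (q - p) * (1 - q * (q - p)) / (p * q) := by
        refine div_nonneg (mul_nonneg (by linarith) ?_) (by positivity)
        nlinarith
      linarith
    linarith

/-- The logarithmic analogue: the telescoping correction `1/v - 1/(v + z)` again pays for dividing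
by the older design. -/
lemma sum_sq_div_le {lam : ℝ} (hlam : 1 ≤ lam) {ζ : ℕ → ℝ} (a : ℕ) {b : ℕ} (hab : a ≤ b)
    (hζ : ∀ t ∈ Finset.Ico a b, ζ t ^ 2 ≤ 1) :
    ∑ t ∈ Finset.Ico a b, ζ t ^ 2 / (lam + ∑ s ∈ Finset.Ico a t, ζ s ^ 2)
      ≤ Real.log ((lam + ∑ s ∈ Finset.Ico a b, ζ s ^ 2) / lam) + 1 / lam
        - 1 / (lam + ∑ s ∈ Finset.Ico a b, ζ s ^ 2) := by
  have hlam0 : 0 < lam := by linarith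
  induction b, hab using Nat.le_induction with
  | base => simp [hlam0.ne']
  | succ b hab ih =>
    have hih := ih fun t ht => hζ t (Finset.Ico_subset_Ico_right (Nat.le_succ b) ht)
    have hb := hζ b (Finset.mem_Ico.2 ⟨hab, Nat.lt_succ_self b⟩)
    have hsum : ∑ s ∈ Finset.Ico a (b + 1), ζ s ^ 2
        = ∑ s ∈ Finset.Ico a b, ζ s ^ 2 + ζ b ^ 2 := Finset.sum_Ico_succ_top hab _
    rw [Finset.sum_Ico_succ_top hab, hsum]
    set v := lam + ∑ s ∈ Finset.Ico a b, ζ s ^ 2 with hv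
    have hv0 : 0 < v := by positivity
    rw [← add_assoc, ← hv]
    set z := ζ b ^ 2 with hz
    have hz0 : 0 ≤ z := sq_nonneg _
    have hlog : Real.log ((v + z) / lam) = Real.log (v / lam) + Real.log ((v + z) / v) := by
      rw [← Real.log_mul (by positivity) (by positivity)]
      congr 1
      field_simp
    have h1 := Real.one_sub_inv_le_log_of_pos (x := (v + z) / v) (by positivity)
    have h2 : z / v ≤ 1 - ((v + z) / v)⁻¹ + 1 / v - 1 / (v + z) := by
      have : 1 - ((v + z) / v)⁻¹ + 1 / v - 1 / (v + z) - z / v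
          = z * (1 - z) / (v * (v + z)) := by
        field_simp
        ring
      have h3 : 0 ≤ z * (1 - z) / (v * (v + z)) :=
        div_nonneg (mul_nonneg hz0 (by linarith)) (by positivity)
      linarith
    linarith

end Potential

/-! ### The one-dimensional problem along the optimal direction -/

section SecondPhase

variable {d : ℕ} {P : Params} {E : Env d} {x : ℕ → Vec d} {z : ℕ → ℝ} {u : Vec d} {n t : ℕ}

lemma design1_pos (hlam : 0 < P.lam) (x : ℕ → Vec d) (u : Vec d) (n t : ℕ) :
    0 < design1 P.lam x u n t := by
  unfold design1
  positivity

/-- The largest scalar of the pessimistic set is almost as large as that of the optimal action. -/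
lemma le_of_isGreatest_pess1 (hP : P.Valid) (hE : E.Valid P) {c : ℝ} (hc : 0 < c)
    (hu : E.xstar = c • u) {γ : ℝ} (hγ : 0 ≤ γ)
    (hconf : estimate1 P.lam x z u n t
        + P.β 1 ((t : ℝ) - n) / √(design1 P.lam x u n t)
      ≤ inner ℝ E.a u + γ / √(design1 P.lam x u n t))
    {ξ : ℝ} (hξ : IsGreatest (pess1 P E.X x z u n t) ξ) :
    0 ≤ ξ ∧ c ≤ ξ * (1 + c * γ / (P.b * √(design1 P.lam x u n t))) := by
  have hb := hP.b_pos
  set r := √(design1 P.lam x u n t) with hr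
  have hr0 : 0 < r := Real.sqrt_pos.2 (design1_pos hP.lam_pos x u n t)
  set G := c * γ / (P.b * r) with hG
  have hG0 : 0 ≤ G := by positivity
  have hζ0 : 0 ≤ c / (1 + G) := by positivity
  -- The factor `1 + G` is chosen so that the upper estimate of the constraint value at `c / (1 +
  -- G)` is exactly `b`; maximality of `ξ` then gives the bound.
  have hmem : c / (1 + G) ∈ pess1 P E.X x z u n t := by
    refine ⟨?_, ?_⟩
    · have h := hE.smul_mem hE.xstar_mem.1 (c := 1 / (1 + G)) (by positivity)
        ((div_le_one (by positivity)).2 (by linarith))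
      rwa [hu, smul_smul, one_div_mul_eq_div] at h
    · rw [abs_of_nonneg hζ0, ← hr]
      have hfeas : inner ℝ E.a u ≤ P.b / c := by
        have h := hE.xstar_mem.2
        rw [hu, inner_smul_right] at h
        rw [le_div_iff₀ hc]
        linarith
      calc _ = c / (1 + G) * (estimate1 P.lam x z u n t + P.β 1 ((t : ℝ) - n) / r) := by ring
        _ ≤ c / (1 + G) * (P.b / c + γ / r) :=
            mul_le_mul_of_nonneg_left (by linarith) hζ0
        _ = P.b := by
            rw [hG]
            field_simp
        _ ≤ P.b := le_rfl
  have h := hξ.2 hmem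
  exact ⟨hζ0.trans h, by rwa [div_le_iff₀ (by positivity)] at h⟩

/-- The total loss of scalars that satisfy the self-bounding inequality of the second phase. -/
lemma sum_one_sub_div_le {lam b c γ : ℝ} (hlam : 1 ≤ lam) (hb : 0 < b) (hc : 0 < c) (hc1 : c ≤ 1)
    (hγ : 0 ≤ γ) {ξ : ℕ → ℝ} {n T : ℕ} (hnT : n ≤ T) (hT : lam ≤ T * c ^ 2)
    (hξ0 : ∀ t ∈ Finset.Ico (n + 1) (T + 1), 0 ≤ ξ t)
    (hξ : ∀ t ∈ Finset.Ico (n + 1) (T + 1),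
      c ≤ ξ t * (1 + c * γ / (b * √(lam + ∑ s ∈ Finset.Ico (n + 1) t, ξ s ^ 2)))) :
    ∑ t ∈ Finset.Ico (n + 1) (T + 1), (1 - ξ t / c)
      ≤ 2 * γ / b * √T + γ ^ 2 / b ^ 2 * (Real.log (1 + T / lam) + 1) := by
  have hlam0 : 0 < lam := by linarith
  -- Truncating at `c` bounds the total design by `lam + T c²`, which later cancels the factor `1 /
  -- c`. The self-bounding inequality survives: the truncated design is smaller, and where the
  -- truncation acts the scalar equals `c`.
  set ζ : ℕ → ℝ := fun t => min (ξ t) c with hζ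
  have hζ0 : ∀ t ∈ Finset.Ico (n + 1) (T + 1), 0 ≤ ζ t := fun t ht => le_min (hξ0 t ht) hc.le
  have hζ1 : ∀ t ∈ Finset.Ico (n + 1) (T + 1), ζ t ^ 2 ≤ 1 := fun t ht =>
    pow_le_one₀ (hζ0 t ht) ((min_le_right _ _).trans hc1)
  set v : ℕ → ℝ := fun t => lam + ∑ s ∈ Finset.Ico (n + 1) t, ζ s ^ 2 with hv
  have hv0 : ∀ t, 0 < v t := fun t => by positivity
  have hterm : ∀ t ∈ Finset.Ico (n + 1) (T + 1),
      1 - ξ t / c ≤ γ / (b * c) * (ζ t ^ 2 / √(v t)) + γ ^ 2 / b ^ 2 * (ζ t ^ 2 / v t) := by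
    intro t ht
    have hr : 0 < √(v t) := Real.sqrt_pos.2 (hv0 t)
    have hsub : ∀ s ∈ Finset.Ico (n + 1) t, s ∈ Finset.Ico (n + 1) (T + 1) := fun s hs => by
      rw [Finset.mem_Ico] at hs ht ⊢
      exact ⟨hs.1, by omega⟩
    have hle : v t ≤ lam + ∑ s ∈ Finset.Ico (n + 1) t, ξ s ^ 2 := by
      refine add_le_add le_rfl (Finset.sum_le_sum fun s hs => ?_)
      exact pow_le_pow_left₀ (hζ0 s (hsub s hs)) (min_le_left _ _) 2
    set G := c * γ / (b * √(v t)) with hG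
    have hG0 : 0 ≤ G := by positivity
    have hkey : c ≤ ζ t * (1 + G) := by
      rcases le_total (ξ t) c with h | h
      · have h1 : ζ t = ξ t := min_eq_left h
        rw [h1]
        refine (hξ t ht).trans (mul_le_mul_of_nonneg_left ?_ (hξ0 t ht))
        have := Real.sqrt_le_sqrt hle
        rw [hG]
        gcongr
      · have h1 : ζ t = c := min_eq_right h
        rw [h1]
        nlinarith
    have h1 : 1 - ξ t / c ≤ (c - ζ t) / c := by
      rw [sub_div, div_self hc.ne']
      have := div_le_div_of_nonneg_right (min_le_left (ξ t) c) hc.le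
      linarith
    refine h1.trans ?_
    have hz0 := hζ0 t ht
    have h2 : γ / (b * c) * (ζ t ^ 2 / √(v t)) + γ ^ 2 / b ^ 2 * (ζ t ^ 2 / v t)
        = ζ t ^ 2 * (1 + G) * G / c ^ 2 := by
      rw [hG]
      have hsq : v t = √(v t) ^ 2 := (Real.sq_sqrt (hv0 t).le).symm
      generalize √(v t) = r at hsq hr
      rw [hsq]
      field_simp
    rw [h2, div_le_div_iff₀ hc (by positivity)]
    -- The inequality `c ≤ ζ (1 + G)` is used twice, once for the difference `c - ζ` and once for
    -- the factor `c`. This produces the square `ζ²` that the potential sums require.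
    have h3 : c - ζ t ≤ ζ t * G := by linarith
    have h4 : ζ t * G * c ≤ ζ t * G * (ζ t * (1 + G)) :=
      mul_le_mul_of_nonneg_left hkey (by positivity)
    have h5 : (c - ζ t) * c ≤ ζ t ^ 2 * (1 + G) * G := by nlinarith
    calc (c - ζ t) * c ^ 2 = (c - ζ t) * c * c := by ring
      _ ≤ _ := mul_le_mul_of_nonneg_right h5 hc.le
  refine (Finset.sum_le_sum hterm).trans ?_
  rw [Finset.sum_add_distrib, ← Finset.mul_sum, ← Finset.mul_sum]
  have hvend : v (T + 1) ≤ lam + T * c ^ 2 := by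
    refine add_le_add le_rfl ?_
    calc ∑ s ∈ Finset.Ico (n + 1) (T + 1), ζ s ^ 2
        ≤ ∑ s ∈ Finset.Ico (n + 1) (T + 1), c ^ 2 :=
          Finset.sum_le_sum fun s hs => pow_le_pow_left₀ (hζ0 s hs) (min_le_right _ _) 2
      _ ≤ T * c ^ 2 := by
          rw [Finset.sum_const, nsmul_eq_mul, Nat.card_Ico]
          refine mul_le_mul_of_nonneg_right ?_ (sq_nonneg c)
          exact_mod_cast (by omega : T + 1 - (n + 1) ≤ T)
  have hs1 := sum_sq_div_sqrt_le hlam (ζ := ζ) (n + 1) (b := T + 1) (by omega) hζ1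
  have hs2 := sum_sq_div_le hlam (ζ := ζ) (n + 1) (b := T + 1) (by omega) hζ1
  change _ ≤ 2 * √(v (T + 1)) - 2 * √lam + 1 / √lam - 1 / √(v (T + 1)) at hs1
  change _ ≤ Real.log (v (T + 1) / lam) + 1 / lam - 1 / v (T + 1) at hs2
  have hA : ∑ t ∈ Finset.Ico (n + 1) (T + 1), ζ t ^ 2 / √(v t) ≤ 2 * (c * √T) := by
    refine hs1.trans ?_
    set l := √lam with hl
    have hl1 : 1 ≤ l := Real.one_le_sqrt.2 hlam
    set A := c * √T with hA
    have hA2 : A ^ 2 = T * c ^ 2 := by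
      rw [hA, mul_pow, Real.sq_sqrt (Nat.cast_nonneg T)]
      ring
    have hl2 : l ^ 2 = lam := Real.sq_sqrt hlam0.le
    have hA0 : 0 ≤ A := by positivity
    have hA1 : 1 ≤ A := by nlinarith
    have hinv : 1 / l ≤ 1 := (div_le_one (by linarith)).2 hl1
    have hinv0 : 0 < 1 / l := by positivity
    have hli : l * (1 / l) = 1 := by field_simp
    -- The hypothesis `lam ≤ T c²` gives `A ≥ l ≥ 1`. This lets the root absorb the boundary term `1
    -- / l`, so the sum is at most `2A` with no remainder.
    have h1 : √(v (T + 1)) ≤ A + l - 1 / l / 2 := by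
      refine Real.sqrt_le_iff.2 ⟨by linarith, hvend.trans ?_⟩
      rw [← hA2, ← hl2]
      nlinarith
    have h2 : 0 ≤ 1 / √(v (T + 1)) := by positivity
    linarith
  have hB : ∑ t ∈ Finset.Ico (n + 1) (T + 1), ζ t ^ 2 / v t ≤ Real.log (1 + T / lam) + 1 := by
    refine hs2.trans ?_
    have h1 : v (T + 1) / lam ≤ 1 + T / lam := by
      rw [div_le_iff₀ hlam0]
      refine hvend.trans ?_
      have : (1 + T / lam) * lam = lam + T := by field_simp
      rw [this]
      have := mul_le_mul_of_nonneg_left (pow_le_one₀ hc.le hc1 (n := 2)) (Nat.cast_nonneg (α := ℝ) T)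
      linarith
    have h2 := Real.log_le_log (div_pos (hv0 _) hlam0) h1
    have h3 : 1 / lam ≤ 1 := (div_le_one hlam0).2 hlam
    have h4 : 0 ≤ 1 / v (T + 1) := (one_div_pos.2 (hv0 _)).le
    linarith
  calc _ ≤ γ / (b * c) * (2 * (c * √T)) + γ ^ 2 / b ^ 2 * (Real.log (1 + T / lam) + 1) := by
        gcongr
    _ = _ := by
        congr 1
        field_simp

end SecondPhase

/-! ### Numerical comparisons behind the constants -/

section Numerics

/-- If the logarithm `l` were below 6, convexity of `exp` on `[0, 6]` and `e⁶ ≤ 432 = 6 * 72` would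
give `r < 72 l`. -/
lemma six_le_log {r : ℝ} (hr0 : 0 < r) (hr : 72 * Real.log (1 + r) ≤ r) :
    6 ≤ Real.log (1 + r) := by
  by_contra! hlt
  have hl0 : 0 < Real.log (1 + r) := Real.log_pos (by linarith)
  set l := Real.log (1 + r) with hl
  have hexp : Real.exp l = 1 + r := Real.exp_log (by linarith)
  have hconv := convexOn_exp.2 (Set.mem_univ (0 : ℝ)) (Set.mem_univ (6 : ℝ))
    (show 0 ≤ 1 - l / 6 by linarith) (show 0 ≤ l / 6 by positivity) (by ring)
  simp only [smul_eq_mul, mul_zero, zero_add, Real.exp_zero, mul_one] at hconv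
  rw [div_mul_cancel₀ l (by norm_num : (6 : ℝ) ≠ 0), hexp] at hconv
  have h6 : Real.exp 6 ≤ 432 := by
    have h1 : Real.exp 6 = Real.exp 1 ^ 6 := by rw [← Real.exp_nat_mul]; norm_num
    rw [h1]
    calc Real.exp 1 ^ 6 ≤ 2.7182818286 ^ 6 :=
          pow_le_pow_left₀ (Real.exp_pos 1).le Real.exp_one_lt_d9.le 6
      _ ≤ 432 := by norm_num
  nlinarith

/-- Dropping `d` from the denominator costs at most `log d ≤ 2 (√d - 1)`. Since `√d ≥ 1.25` and the
logarithm on the right is at least 6, the factor `√d` absorbs this and the extra 1. -/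
lemma log_add_one_le {T lam : ℝ} {d : ℕ} (hd : 2 ≤ d) (hT : 0 ≤ T) (hlam : 0 < lam)
    (hL : 6 ≤ Real.log (1 + T / (lam * d))) :
    Real.log (1 + T / lam) + 1 ≤ √d * Real.log (1 + T / (lam * d)) := by
  have hd' : (2 : ℝ) ≤ d := by exact_mod_cast hd
  have hd0 : (0 : ℝ) < d := by linarith
  have h1 : Real.log (1 + T / lam) ≤ Real.log d + Real.log (1 + T / (lam * d)) := by
    rw [← Real.log_mul hd0.ne' (by positivity)]
    refine Real.log_le_log (by positivity) ?_
    have : (d : ℝ) * (1 + T / (lam * d)) = d + T / lam := by field_simp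
    linarith
  have h2 : Real.log d ≤ 2 * (√d - 1) := by
    have h := Real.log_le_sub_one_of_pos (Real.sqrt_pos.2 hd0)
    rw [Real.log_sqrt hd0.le] at h
    linarith
  have h3 : (1.25 : ℝ) ≤ √d := Real.le_sqrt_of_sq_le (by norm_num; linarith)
  nlinarith

/-- Comparison of the loss in the second phase with the claimed bound. -/
lemma second_phase_numeric {S b γ β₁ βd Δ T L l : ℝ} {d : ℕ} (hS : 0 < S) (hb : 0 < b)
    (hγ0 : 0 ≤ γ) (hγ1 : γ ≤ (1 + √2) * β₁) (hγ2 : γ ≤ 2 * βd) (hβ : 0 ≤ βd) (hβ₁ : 0 ≤ β₁)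
    (hΔ : 0 < Δ) (hΔS : Δ ≤ S) (hT : 0 ≤ T) (hL : 6 ≤ L) (hl : l ≤ √d * L)
    (hTB : 8 * d * (1 + 2 * S / b) ^ 2 * βd ^ 2 * L / Δ ^ 2 ≤ T) :
    S * (2 * γ / b * √T + γ ^ 2 / b ^ 2 * l) ≤ 2 * (1 + S / b) * β₁ * √(2 * T * L) := by
  have hL0 : 0 ≤ L := by linarith
  have hs : 0 < S / b := by positivity
  -- Here the lower bound on `T` enters: one factor `γ / b` of the second-order term is traded for
  -- `√T`.
  have hroot : γ / b * √(8 * d * L) ≤ √T := by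
    refine Real.le_sqrt_of_sq_le (le_trans ?_ hTB)
    rw [mul_pow, Real.sq_sqrt (by positivity), le_div_iff₀ (by positivity)]
    have h1 : γ / b * Δ ≤ (1 + 2 * S / b) * βd := by
      calc γ / b * Δ ≤ (2 * βd) / b * S := by gcongr
        _ = 2 * S / b * βd := by ring
        _ ≤ _ := by nlinarith
    have h2 := pow_le_pow_left₀ (by positivity) h1 2
    have h3 : 0 ≤ 8 * d * L := by positivity
    nlinarith [mul_le_mul_of_nonneg_left h2 h3]
  have hsqL : √L ^ 2 = L := Real.sq_sqrt hL0
  have hsq8 : √(8 * d * L) = √8 * √d * √L := by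
    rw [Real.sqrt_mul (by positivity), Real.sqrt_mul (by norm_num)]
  have h8 : 0 < √(8 : ℝ) := by positivity
  have hterm2 : S * (γ ^ 2 / b ^ 2 * l) ≤ (S / b) * γ * √T * √L * (1 / √8) := by
    calc S * (γ ^ 2 / b ^ 2 * l) ≤ S * (γ ^ 2 / b ^ 2 * (√d * L)) := by gcongr
      _ = (S / b) * γ * (γ / b * √(8 * d * L)) * √L * (1 / √8) := by
          rw [hsq8]
          nth_rewrite 1 [← hsqL]
          field_simp
      _ ≤ _ := by gcongr
  have h6 : √6 ≤ √L := Real.sqrt_le_sqrt hL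
  have h60 : 0 < √(6 : ℝ) := by positivity
  have hterm1 : S * (2 * γ / b * √T) ≤ (S / b) * γ * √T * √L * (2 / √6) := by
    calc S * (2 * γ / b * √T) = (S / b) * γ * √T * √6 * (2 / √6) := by field_simp
      _ ≤ _ := by gcongr
  -- The two losses, normalized by `(S/b) * γ * √T * √L`, are `1/√8` from the second-order term and
  -- `2/√6` from the main term. The inequality leaves little room, hence the decimals.
  have hnum : (1 + √2) * (1 / √8 + 2 / √6) ≤ 2 * √2 := by
    have e2 : √2 ≤ (1.41422 : ℝ) := Real.sqrt_le_iff.2 (by norm_num)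
    have e2' : (1.41421 : ℝ) ≤ √2 := Real.le_sqrt_of_sq_le (by norm_num)
    have e8 : (2.828 : ℝ) ≤ √8 := Real.le_sqrt_of_sq_le (by norm_num)
    have e6 : (2.449 : ℝ) ≤ √6 := Real.le_sqrt_of_sq_le (by norm_num)
    have f8 : 1 / √8 ≤ (0.35361 : ℝ) := by
      rw [div_le_iff₀ h8]
      linarith
    have f6 : 2 / √6 ≤ (0.81667 : ℝ) := by
      rw [div_le_iff₀ h60]
      linarith
    calc (1 + √2) * (1 / √8 + 2 / √6) ≤ (1 + 1.41422) * (0.35361 + 0.81667) := by gcongr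
      _ ≤ 2 * 1.41421 := by norm_num
      _ ≤ _ := by linarith
  have hrhs : √(2 * T * L) = √2 * √T * √L := by
    rw [Real.sqrt_mul (by positivity), Real.sqrt_mul (by norm_num)]
  calc S * (2 * γ / b * √T + γ ^ 2 / b ^ 2 * l)
      ≤ (S / b) * γ * √T * √L * (1 / √8 + 2 / √6) := by
        rw [mul_add, mul_add]
        linarith
    _ ≤ (S / b) * ((1 + √2) * β₁) * √T * √L * (1 / √8 + 2 / √6) := by gcongr
    _ = (S / b) * β₁ * √T * √L * ((1 + √2) * (1 / √8 + 2 / √6)) := by ring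
    _ ≤ (S / b) * β₁ * √T * √L * (2 * √2) := by gcongr
    _ ≤ (1 + S / b) * β₁ * √T * √L * (2 * √2) := by gcongr; linarith
    _ = _ := by rw [hrhs]; ring

end Numerics

/-! ### Directions, counts and the switching round -/

section Directions

variable {d : ℕ} {x : ℕ → Vec d} {u v w : Vec d}

lemma SameDir.symm (h : SameDir u v) : SameDir v u := by
  obtain ⟨α, hα, rfl⟩ := h
  exact ⟨α⁻¹, inv_pos.2 hα, by rw [smul_smul, inv_mul_cancel₀ hα.ne', one_smul]⟩

lemma SameDir.trans (h : SameDir u v) (h' : SameDir v w) : SameDir u w := by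
  obtain ⟨α, hα, rfl⟩ := h
  obtain ⟨β, hβ, rfl⟩ := h'
  exact ⟨α * β, mul_pos hα hβ, smul_smul _ _ _⟩

lemma SameDir.eq_normalize (h : SameDir u v) (hu : ‖u‖ = 1) : v = ‖v‖ • u := by
  obtain ⟨α, hα, rfl⟩ := h.symm
  rw [norm_smul, hu, Real.norm_of_nonneg hα.le, mul_one]

lemma sameDir_iff_of_norm_eq_one (hu : ‖u‖ = 1) :
    SameDir v u ↔ 0 < inner ℝ u v ∧ v = inner ℝ u v • u := by
  constructor
  · rintro ⟨α, hα, rfl⟩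
    have : inner ℝ u (α • u) = α := by
      rw [inner_smul_right, real_inner_self_eq_norm_sq, hu]
      ring
    rw [this]
    exact ⟨hα, rfl⟩
  · exact fun h => ⟨_, h.1, h.2⟩

lemma measurableSet_sameDir (hu : ‖u‖ = 1) : MeasurableSet {v : Vec d | SameDir v u} := by
  simp only [sameDir_iff_of_norm_eq_one hu, Set.ofPred_and]
  refine MeasurableSet.inter ?_ ?_
  · exact (isOpen_lt continuous_const (by fun_prop)).measurableSet
  · exact (isClosed_eq (by fun_prop) (by fun_prop)).measurableSet

lemma dirCount_congr (h : SameDir u v) (n : ℕ) : dirCount x u n = dirCount x v n := by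
  unfold dirCount
  congr 1
  ext t
  simp only [Finset.mem_filter]
  exact and_congr_right fun _ => ⟨fun h' => h'.trans h, fun h' => h'.trans h.symm⟩

lemma dirCount_mono (x : ℕ → Vec d) (u : Vec d) : Monotone (dirCount x u) := by
  classical
  exact fun _ _ h =>
    Finset.card_le_card (Finset.filter_subset_filter _ (Finset.Icc_subset_Icc_right h))

lemma dirCount_succ_le (x : ℕ → Vec d) (u : Vec d) (n : ℕ) :
    dirCount x u (n + 1) ≤ dirCount x u n + 1 := by
  classical
  unfold dirCount
  rw [← Finset.insert_Icc_right_eq_Icc_add_one (by omega), Finset.filter_insert]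
  split_ifs
  · exact Finset.card_insert_le _ _
  · omega

variable {E : Env d}

lemma dirCount_add_wrongCount (x : ℕ → Vec d) (n : ℕ) :
    dirCount x E.xstar n + E.wrongCount x n = n := by
  classical
  unfold dirCount Env.wrongCount
  rw [Finset.card_filter_add_card_filter_not]
  simp

lemma dirCount_le_wrongCount (h : ¬ SameDir u E.xstar) (n : ℕ) :
    dirCount x u n ≤ E.wrongCount x n := by
  classical
  unfold dirCount Env.wrongCount
  refine Finset.card_le_card fun t ht => ?_
  rw [Finset.mem_filter] at ht ⊢
  exact ⟨ht.1, fun h' => h (ht.2.symm.trans h')⟩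

variable {B : ℝ} {n m T : ℕ}

/-- A switch is the first round with an over-played direction, so any two switching rounds coincide
even if their directions differ. -/
lemma Switch.le (h : Switch B x n u) (h' : Switch B x m v) : n ≤ m := by
  by_contra! hlt
  exact absurd (h.2.2 m hlt v h'.1) (not_le.2 h'.2.1)

lemma exists_switch (hu : ‖u‖ = 1) (h : B < dirCount x u n) : ∃ m ≤ n, ∃ v, Switch B x m v := by
  classical
  have hex : ∃ m, ∃ v : Vec d, ‖v‖ = 1 ∧ B < dirCount x v m := ⟨n, u, hu, h⟩
  obtain ⟨v, hv, hlt⟩ := Nat.find_spec hex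
  refine ⟨Nat.find hex, Nat.find_min' hex ⟨u, hu, h⟩, v, hv, hlt, fun k hk w hw => ?_⟩
  by_contra! hB
  exact Nat.find_min hex hk ⟨w, hw, hB⟩

variable {P : Params} {y z : ℕ → ℝ} {X : Set (Vec d)}

lemma PDOPLBStep.mem (h : PDOPLBStep P X B x y z n) : x n ∈ X := by
  by_cases hs : ∃ m < n, ∃ u, Switch B x m u
  · obtain ⟨m, hm, u, hu⟩ := hs
    obtain ⟨ξ, hξ, hx⟩ := h.2 m hm u hu
    rw [hx]
    exact hξ.1.1
  · push Not at hs
    exact (h.1 hs).1.1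

/-- The round in which the threshold is crossed is still an OPLB round. A crossing in round `T`
itself leaves no second phase. -/
lemma PDOPLBStep.exists_phases (h : ∀ t ∈ Finset.Icc 1 T, PDOPLBStep P X B x y z t) :
    ∃ N ≤ T, (∀ t ∈ Finset.Icc 1 N, OPLBStep P X x y z t) ∧
      (∀ k < N, ∀ v : Vec d, ‖v‖ = 1 → (dirCount x v k : ℝ) ≤ B) ∧
      (N = T ∨ N < T ∧ ∃ u, Switch B x N u) := by
  by_cases hs : ∃ m < T, ∃ u, Switch B x m u
  · obtain ⟨m, hm, u, hu⟩ := hs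
    refine ⟨m, hm.le, fun t ht => ?_, hu.2.2, Or.inr ⟨hm, u, hu⟩⟩
    rw [Finset.mem_Icc] at ht
    refine (h t (Finset.mem_Icc.2 ⟨ht.1, by omega⟩)).1 fun n hn v hv => ?_
    have := hu.le hv
    omega
  · push Not at hs
    refine ⟨T, le_rfl, fun t ht => ?_, fun k hk v hv => ?_, Or.inl rfl⟩
    · refine (h t ht).1 fun n hn => hs n ?_
      rw [Finset.mem_Icc] at ht
      omega
    · by_contra! hB
      obtain ⟨m, hm, w, hw⟩ := exists_switch hv hB
      exact hs m (by omega) w hw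

end Directions

/-! ### Lower bounds for the threshold -/

section Threshold

variable {d : ℕ} {P : Params} {E : Env d} {T : ℕ}

lemma log_one_add_nonneg (hP : P.Valid) {t : ℝ} (ht : 0 ≤ t) (d : ℕ) :
    0 ≤ Real.log (1 + t / (P.lam * d)) := by
  have := hP.lam_pos
  exact Real.log_nonneg (le_add_of_nonneg_right (by positivity))

lemma log_one_add_mono (hP : P.Valid) {s t : ℝ} (hs : 0 ≤ s) (hst : s ≤ t) (d : ℕ) :
    Real.log (1 + s / (P.lam * d)) ≤ Real.log (1 + t / (P.lam * d)) := by
  have := hP.lam_pos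
  refine Real.log_le_log (by positivity) ?_
  gcongr

/-- Here `72 = 8 * 9`: `S/b ≥ 1` gives `(1 + 2S/b)² ≥ 9`, and `β² ≥ lam * S²` because the radius
contains the bias term. -/
lemma Env.le_Bbar (hP : P.Valid) (hgap : 0 < E.gap P.b) (T : ℕ) :
    72 * d * P.lam * Real.log (1 + T / (P.lam * d)) * (P.S / E.gap P.b) ^ 2 ≤ E.Bbar P T := by
  have hL := log_one_add_nonneg hP (Nat.cast_nonneg T) d
  have hs := hP.one_le_S_div
  have hlam := hP.lam_pos
  have hS := hP.S_pos
  have h1 : P.lam * P.S ^ 2 ≤ P.β d T ^ 2 := by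
    have h := pow_le_pow_left₀ (by positivity) (hP.le_β d T) 2
    rwa [mul_pow, Real.sq_sqrt hlam.le] at h
  have h2 : 9 ≤ (1 + 2 * P.S / P.b) ^ 2 := by
    rw [mul_div_assoc]
    nlinarith
  unfold Env.Bbar
  calc _ = 8 * d * 9 * (P.lam * P.S ^ 2) * Real.log (1 + T / (P.lam * d)) / E.gap P.b ^ 2 := by
        rw [div_pow]
        ring
    _ ≤ _ := by gcongr

lemma Env.Valid.mul_log_le_Bbar (hE : E.Valid P) (hP : P.Valid) (hgap : 0 < E.gap P.b) (T : ℕ) :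
    72 * d * P.lam * Real.log (1 + T / (P.lam * d)) ≤ E.Bbar P T := by
  refine le_trans ?_ (Env.le_Bbar hP hgap T)
  have hL := log_one_add_nonneg hP (Nat.cast_nonneg T) d
  have hlam := hP.lam_pos
  have h : 1 ≤ P.S / E.gap P.b := (one_le_div hgap).2 (hE.gap_le_S hP)
  exact le_mul_of_one_le_right (by positivity) (one_le_pow₀ h)

lemma Env.Valid.Bbar_nonneg (hE : E.Valid P) (hP : P.Valid) (hgap : 0 < E.gap P.b) (T : ℕ) :
    0 ≤ E.Bbar P T := by
  refine le_trans ?_ (hE.mul_log_le_Bbar hP hgap T)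
  have hL := log_one_add_nonneg hP (Nat.cast_nonneg T) d
  have hlam := hP.lam_pos
  positivity

/-- With `D = lam * d`, one has `D log (1 + T/D) ≥ D T / (D + T) ≥ 1/2`. Some such absolute bound is
needed to absorb the last round of the first phase. -/
lemma Env.Valid.le_Bbar_of_one_le (hE : E.Valid P) (hP : P.Valid) (hgap : 0 < E.gap P.b)
    (hd : 1 ≤ d) (hT : 1 ≤ T) : 36 ≤ E.Bbar P T := by
  refine le_trans ?_ (hE.mul_log_le_Bbar hP hgap T)
  have hlam := hP.lam_ge
  have hd' : (1 : ℝ) ≤ d := by exact_mod_cast hd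
  have hT' : (1 : ℝ) ≤ T := by exact_mod_cast hT
  set D : ℝ := P.lam * d with hD
  have hD1 : 1 ≤ D := by nlinarith
  have h := Real.one_sub_inv_le_log_of_pos (x := 1 + T / D) (by positivity)
  have h2 : 1 / 2 ≤ D * (1 - (1 + T / D)⁻¹) := by
    have : D * (1 - (1 + T / D)⁻¹) - 1 / 2 = (2 * (D * T) - D - T) / (2 * (D + T)) := by
      field_simp
      ring
    have h3 : 0 ≤ (2 * (D * T) - D - T) / (2 * (D + T)) :=
      div_nonneg (by nlinarith) (by positivity)
    linarith
  have h4 : D * (1 - (1 + T / D)⁻¹) ≤ D * Real.log (1 + T / D) :=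
    mul_le_mul_of_nonneg_left h (by linarith)
  have h5 : 72 * d * P.lam * Real.log (1 + T / D) = 72 * (D * Real.log (1 + T / D)) := by
    rw [hD]
    ring
  linarith

end Threshold

/-! ### Length and regret of the first phase -/

section FirstPhase

variable {d : ℕ} {P : Params} {E : Env d} {x : ℕ → Vec d} {ε η : ℕ → ℝ} {N T : ℕ}

lemma Env.Valid.norm_xstar_pos (hE : E.Valid P) : 0 < ‖E.xstar‖ := norm_pos_iff.2 hE.xstar_ne_zero

/-- The direction of the optimal action. -/
def Env.dir (E : Env d) : Vec d := ‖E.xstar‖⁻¹ • E.xstar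

lemma Env.Valid.norm_dir (hE : E.Valid P) : ‖E.dir‖ = 1 := by
  have := hE.norm_xstar_pos
  rw [Env.dir, norm_smul, norm_inv, norm_norm, inv_mul_cancel₀ this.ne']

lemma Env.Valid.sameDir_dir (hE : E.Valid P) : SameDir E.dir E.xstar :=
  ⟨_, inv_pos.2 hE.norm_xstar_pos, rfl⟩

lemma Env.Valid.xstar_eq (hE : E.Valid P) : E.xstar = ‖E.xstar‖ • E.dir :=
  hE.sameDir_dir.eq_normalize hE.norm_dir

/-- For `s = S/b ≥ 1` the ratio `(1 + s) / (1 + 2s)` is at most `2/3`; squaring gives `4/9`. -/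
lemma GoodOPLB.wrongCount_le_Bbar (hP : P.Valid) (hE : E.Valid P) (hd : 1 ≤ d)
    (hgap : 0 < E.gap P.b) (hNT : N ≤ T) (h : GoodOPLB P E x ε η N) :
    (E.wrongCount x N : ℝ) ≤ 4 / 9 * E.Bbar P T := by
  rcases Nat.eq_zero_or_pos N with rfl | hN
  · have := hE.Bbar_nonneg hP hgap T
    simp only [Env.wrongCount]
    simpa using this
  refine (h.wrongCount_le hP hE hd hgap).trans ?_
  have hNT' : (N : ℝ) ≤ T := by exact_mod_cast hNT
  have h1 := hP.β_mono d (s := N) (t := T) (by exact_mod_cast hN) hNT'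
  have h2 := log_one_add_mono hP (Nat.cast_nonneg N) hNT' d
  have h3 := log_one_add_nonneg hP (Nat.cast_nonneg N) d
  have h4 := hP.β_pos d N
  have hs := hP.one_le_S_div
  have h5 : (1 + P.S / P.b) ^ 2 ≤ 4 / 9 * (1 + 2 * P.S / P.b) ^ 2 := by
    rw [mul_div_assoc]
    nlinarith
  unfold Env.Bbar
  calc _ ≤ 8 * d * (4 / 9 * (1 + 2 * P.S / P.b) ^ 2) * P.β d T ^ 2
        * Real.log (1 + T / (P.lam * d)) / E.gap P.b ^ 2 := by gcongr
    _ = _ := by ring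

/-- The length of the first phase. -/
lemma GoodOPLB.length_le (hP : P.Valid) (hE : E.Valid P) (hd : 1 ≤ d) (hgap : 0 < E.gap P.b)
    (hNT : N ≤ T) (hT : 1 ≤ T) (h : GoodOPLB P E x ε η N)
    (hdir : ∀ k < N, ∀ v : Vec d, ‖v‖ = 1 → (dirCount x v k : ℝ) ≤ E.Bbar P T) :
    (N : ℝ) ≤ 2 * E.Bbar P T := by
  have hB := hE.le_Bbar_of_one_le hP hgap hd hT
  rcases Nat.eq_zero_or_pos N with rfl | hN
  · simp only [Nat.cast_zero]
    linarith
  -- One round before the end no direction exceeds the threshold, and the last round adds at most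
  -- one play; the wrong rounds fit in the remainder.
  obtain ⟨M, rfl⟩ : ∃ M, N = M + 1 := ⟨N - 1, by omega⟩
  have h1 := hdir M (by omega) E.dir hE.norm_dir
  have h2 : (dirCount x E.dir (M + 1) : ℝ) ≤ dirCount x E.dir M + 1 := by
    exact_mod_cast dirCount_succ_le x E.dir M
  have h3 := h.wrongCount_le_Bbar hP hE hd hgap hNT
  have h4 : (dirCount x E.xstar (M + 1) : ℝ) + E.wrongCount x (M + 1) = (M + 1 : ℕ) := by
    exact_mod_cast dirCount_add_wrongCount x (M + 1)
  rw [← dirCount_congr hE.sameDir_dir] at h4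
  linarith

/-- All plays of a direction other than the optimal one are wrong rounds, which are too few to cross
the threshold. -/
lemma GoodOPLB.eq_dir_of_switch (hP : P.Valid) (hE : E.Valid P) (hd : 1 ≤ d)
    (hgap : 0 < E.gap P.b) (hNT : N ≤ T) (h : GoodOPLB P E x ε η N) {u : Vec d}
    (hu : Switch (E.Bbar P T) x N u) : u = E.dir := by
  have hdir : SameDir u E.xstar := by
    by_contra hne
    have h1 : (dirCount x u N : ℝ) ≤ E.wrongCount x N := by
      exact_mod_cast dirCount_le_wrongCount hne N
    have h2 := h.wrongCount_le_Bbar hP hE hd hgap hNT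
    have h3 := hE.Bbar_nonneg hP hgap T
    have h4 := hu.2.1
    linarith
  have h1 := (hdir.trans hE.sameDir_dir.symm).eq_normalize hu.1
  rw [hE.norm_dir, one_smul] at h1
  exact h1.symm

lemma GoodOPLB.regret_le_Bbar (hP : P.Valid) (hE : E.Valid P) (hd : 1 ≤ d)
    (h : GoodOPLB P E x ε η N) {B : ℝ} (hN : (N : ℝ) ≤ 2 * B) :
    E.regret x N ≤ 4 * (1 + P.S / P.b) * P.β d (2 * B)
      * √(d * B * Real.log (1 + 2 * B / (P.lam * d))) := by
  have hs := hP.one_le_S_div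
  have hβ := hP.β_pos d (2 * B)
  rcases Nat.eq_zero_or_pos N with rfl | hN0
  · have : E.regret x 0 = 0 := by simp [Env.regret]
    rw [this]
    positivity
  refine (h.regret_le hP hE hd).trans ?_
  have h1 := hP.β_mono d (s := N) (t := 2 * B) (by exact_mod_cast hN0) hN
  have h2 := log_one_add_mono hP (Nat.cast_nonneg N) hN d
  have h3 := log_one_add_nonneg hP (Nat.cast_nonneg N) d
  have hB0 : 0 ≤ B := by linarith [Nat.cast_nonneg (α := ℝ) N]
  calc _ ≤ 2 * (1 + P.S / P.b) * P.β d (2 * B)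
        * √(2 * d * (2 * B) * Real.log (1 + 2 * B / (P.lam * d))) := by gcongr
    _ = 2 * (1 + P.S / P.b) * P.β d (2 * B)
        * √(2 ^ 2 * (d * B * Real.log (1 + 2 * B / (P.lam * d)))) := by ring_nf
    _ = _ := by
        rw [Real.sqrt_mul (by norm_num), Real.sqrt_sq (by norm_num)]
        ring

lemma GoodOPLB.regret_le_gap (hP : P.Valid) (hE : E.Valid P) (hd : 1 ≤ d)
    (hgap : 0 < E.gap P.b) (hNT : N ≤ T) (h : GoodOPLB P E x ε η N)
    (hN : (N : ℝ) ≤ 2 * E.Bbar P T) :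
    E.regret x N ≤ 12 * (1 + P.S / P.b) * (1 + 2 * P.S / P.b) * d * P.β d T ^ 2
      * Real.log (1 + T / (P.lam * d)) / E.gap P.b := by
  have hs := hP.one_le_S_div
  have hs2 : 0 ≤ 1 + 2 * P.S / P.b := by
    rw [mul_div_assoc]
    linarith
  have hβ := hP.β_pos d T
  have hL := log_one_add_nonneg hP (Nat.cast_nonneg T) d
  rcases Nat.eq_zero_or_pos N with rfl | hN0
  · have : E.regret x 0 = 0 := by simp [Env.regret]
    rw [this]
    positivity
  refine (h.regret_le hP hE hd).trans ?_
  have hNT' : (N : ℝ) ≤ T := by exact_mod_cast hNT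
  have h1 := hP.β_mono d (s := N) (t := T) (by exact_mod_cast hN0) hNT'
  have h2 := log_one_add_mono hP (Nat.cast_nonneg N) hNT' d
  have h3 := log_one_add_nonneg hP (Nat.cast_nonneg N) d
  set L := Real.log (1 + T / (P.lam * d)) with hLdef
  have hB0 := hE.Bbar_nonneg hP hgap T
  -- Replacing `N` by twice the threshold makes the radicand 32 times a square, so the root is
  -- linear in `1 / Δ`.
  have h4 : √(2 * d * N * Real.log (1 + N / (P.lam * d)))
      ≤ 6 * d * (1 + 2 * P.S / P.b) * P.β d T * L / E.gap P.b := by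
    refine Real.sqrt_le_iff.2 ⟨by positivity, ?_⟩
    calc _ ≤ 2 * d * (2 * E.Bbar P T) * L := by gcongr
      _ = 32 * (d * (1 + 2 * P.S / P.b) * P.β d T * L / E.gap P.b) ^ 2 := by
          unfold Env.Bbar
          rw [← hLdef]
          ring
      _ ≤ 36 * (d * (1 + 2 * P.S / P.b) * P.β d T * L / E.gap P.b) ^ 2 := by
          gcongr
          norm_num
      _ = _ := by ring
  calc _ ≤ 2 * (1 + P.S / P.b) * P.β d T
        * (6 * d * (1 + 2 * P.S / P.b) * P.β d T * L / E.gap P.b) := by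
        gcongr
    _ = _ := by ring

end FirstPhase

/-! ### Regret of the second phase and the split of the total regret -/

section SecondPhaseRegret

variable {d : ℕ} {P : Params} {E : Env d} {x : ℕ → Vec d} {ε η : ℕ → ℝ} {N T : ℕ}

/-- Only the upper side is needed: the regret requires that the algorithm is not too cautious along
`u`. -/
lemma estimate1_le (hlam : 0 < P.lam) {a u : Vec d} {n t : ℕ} {S r : ℝ} (hr : 0 ≤ r)
    (hS : 0 ≤ S) (ha : |inner ℝ a u| ≤ S)
    (hx : ∀ k ∈ Finset.Ico (n + 1) t, x k = (inner ℝ u (x k) : ℝ) • u)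
    (hq : (∑ k ∈ Finset.Ico (n + 1) t, η k * inner ℝ u (x k)) ^ 2 / design1 P.lam x u n t
      ≤ r ^ 2) :
    estimate1 P.lam x (fun k => inner ℝ a (x k) + η k) u n t
      ≤ inner ℝ a u + (r + √P.lam * S) / √(design1 P.lam x u n t) := by
  have hv := design1_pos hlam x u n t
  have hlv : P.lam ≤ design1 P.lam x u n t :=
    le_add_of_nonneg_right (Finset.sum_nonneg fun _ _ => sq_nonneg _)
  have hsum : ∑ s ∈ Finset.Ico (n + 1) t, inner ℝ u (x s) * (inner ℝ a (x s) + η s)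
      = inner ℝ a u * (design1 P.lam x u n t - P.lam)
        + ∑ k ∈ Finset.Ico (n + 1) t, η k * inner ℝ u (x k) := by
    rw [design1, add_sub_cancel_left, Finset.mul_sum, ← Finset.sum_add_distrib]
    refine Finset.sum_congr rfl fun k hk => ?_
    have h : inner ℝ a (x k) = inner ℝ u (x k) * inner ℝ a u := by
      conv_lhs => rw [hx k hk]
      rw [inner_smul_right]
    rw [h]
    ring
  rw [estimate1, hsum]
  set v := design1 P.lam x u n t
  set s := ∑ k ∈ Finset.Ico (n + 1) t, η k * inner ℝ u (x k)
  set φ : ℝ := inner ℝ a u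
  have hw : 0 < √v := Real.sqrt_pos.2 hv
  have hw2 : √v ^ 2 = v := Real.sq_sqrt hv.le
  have h1 : s ≤ r * √v := by
    refine (abs_le_of_sq_le_sq' ?_ (by positivity)).2
    rw [mul_pow, hw2]
    exact (div_le_iff₀ hv).1 hq
  have h2 : -φ * P.lam ≤ √P.lam * S * √v := by
    have h3 : √P.lam ≤ √v := Real.sqrt_le_sqrt hlv
    have h4 : √P.lam ^ 2 = P.lam := Real.sq_sqrt hlam.le
    calc -φ * P.lam ≤ S * P.lam :=
          mul_le_mul_of_nonneg_right ((neg_le_abs φ).trans ha) hlam.le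
      _ = √P.lam * S * √P.lam := by rw [mul_right_comm, ← sq, h4, mul_comm]
      _ ≤ _ := by gcongr
  have h5 : (r + √P.lam * S) / √v = (r * √v + √P.lam * S * √v) / v := by
    rw [← hw2, Real.sqrt_sq hw.le]
    field_simp
  rw [h5, div_le_iff₀ hv, add_mul, div_mul_cancel₀ _ hv.ne']
  linarith

lemma inner_smul_self_of_norm_eq_one {u : Vec d} (hu : ‖u‖ = 1) (ξ : ℝ) :
    inner ℝ u (ξ • u) = ξ := by
  rw [inner_smul_right, real_inner_self_eq_norm_sq, hu]
  ring

/-- A confidence radius along a single direction that is valid with the claimed probability, added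
to the radius that is used by the algorithm. -/
def Params.γ (P : Params) (T : ℕ) : ℝ :=
  (1 + √2) * (P.ρ * √(Real.log ((1 + ((T : ℝ) - 1) / P.lam) / (P.δ / 2))))
    + 2 * (√P.lam * P.S)

lemma Params.β_one_eq (P : Params) (t : ℝ) :
    P.β 1 t = P.ρ * √(Real.log ((1 + (t - 1) / P.lam) / (P.δ / 2))) + √P.lam * P.S := by
  simp [Params.β]

lemma Params.Valid.γ_nonneg (hP : P.Valid) (T : ℕ) : 0 ≤ P.γ T := by
  have := hP.ρ_nonneg
  have := hP.S_pos
  unfold Params.γ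
  positivity

lemma Params.Valid.γ_le_β_one (hP : P.Valid) (T : ℕ) : P.γ T ≤ (1 + √2) * P.β 1 T := by
  have h2 : (1 : ℝ) ≤ √2 := Real.one_le_sqrt.2 (by norm_num)
  have := hP.S_pos
  have hq : 0 ≤ √P.lam * P.S := by positivity
  rw [P.β_one_eq, Params.γ]
  nlinarith

lemma Params.Valid.γ_le_β (hP : P.Valid) (hd : 2 ≤ d) (T : ℕ) : P.γ T ≤ 2 * P.β d T := by
  have hd' : (2 : ℝ) ≤ d := by exact_mod_cast hd
  have h2 : (1 : ℝ) ≤ √2 := Real.one_le_sqrt.2 (by norm_num)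
  have h3 : √2 ≤ √d := Real.sqrt_le_sqrt hd'
  have hρ := hP.ρ_nonneg
  rw [Params.γ, Params.β, Real.sqrt_mul (Nat.cast_nonneg d)]
  set l := √(Real.log ((1 + ((T : ℝ) - 1) / P.lam) / (P.δ / 2)))
  have hp : 0 ≤ P.ρ * l := by positivity
  nlinarith

lemma design1_div_le (hP : P.Valid) {u : Vec d} {t : ℕ} (htN : N + 1 ≤ t) (ht : t ≤ T)
    (hx : ∀ k ∈ Finset.Ico (N + 1) t, |inner ℝ u (x k)| ≤ 1) :
    design1 P.lam x u N t / P.lam ≤ 1 + ((T : ℝ) - 1) / P.lam := by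
  have hlam := hP.lam_pos
  have h1 : ∑ k ∈ Finset.Ico (N + 1) t, (inner ℝ u (x k) : ℝ) ^ 2 ≤ (T : ℝ) - 1 := by
    calc _ ≤ ∑ k ∈ Finset.Ico (N + 1) t, (1 : ℝ) := by
          refine Finset.sum_le_sum fun k hk => ?_
          rw [← sq_abs]
          exact pow_le_one₀ (abs_nonneg _) (hx k hk)
      _ ≤ _ := by
          rw [Finset.sum_const, Nat.card_Ico, nsmul_eq_mul, mul_one, le_sub_iff_add_le]
          exact_mod_cast (by omega : t - (N + 1) + 1 ≤ T)
  rw [design1, add_div, div_self hlam.ne']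
  gcongr

/-- The scalars of the second phase satisfy a self-bounding inequality. -/
lemma second_phase_self_bound (hP : P.Valid) (hE : E.Valid P) {t : ℕ}
    (ht : t ∈ Finset.Ico (N + 1) (T + 1))
    (hstep : ∀ t ∈ Finset.Ico (N + 1) (T + 1), ∃ ξ,
      IsGreatest (pess1 P E.X x (fun k => inner ℝ E.a (x k) + η k) E.dir N t) ξ ∧
        x t = ξ • E.dir)
    (hq : (∑ k ∈ Finset.Ico (N + 1) t, η k * inner ℝ E.dir (x k)) ^ 2
          / design1 P.lam x E.dir N t
        ≤ P.ρ ^ 2 * (Real.log (design1 P.lam x E.dir N t / P.lam) + 2 * Real.log (1 / P.δ))) :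
    0 ≤ (inner ℝ E.dir (x t) : ℝ) ∧ ‖E.xstar‖ ≤ inner ℝ E.dir (x t)
      * (1 + ‖E.xstar‖ * P.γ T / (P.b * √(design1 P.lam x E.dir N t))) := by
  have hlam := hP.lam_pos
  have hS := hP.S_pos
  have hρ := hP.ρ_nonneg
  have hδ := hP.δ_pos
  have hun := hE.norm_dir
  have ht' := Finset.mem_Ico.1 ht
  have hT1 : (1 : ℝ) ≤ T := by exact_mod_cast (by omega : 1 ≤ T)
  have hsub : ∀ k ∈ Finset.Ico (N + 1) t, k ∈ Finset.Ico (N + 1) (T + 1) := fun k hk => by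
    rw [Finset.mem_Ico] at hk ⊢
    omega
  have hφ : |inner ℝ E.a E.dir| ≤ P.S := by
    have h := abs_real_inner_le_norm E.a E.dir
    rw [hun, mul_one] at h
    exact (h.trans hE.norm_a_le).trans (le_max_left _ _)
  have hx : ∀ k ∈ Finset.Ico (N + 1) t, x k = (inner ℝ E.dir (x k) : ℝ) • E.dir := by
    intro k hk
    obtain ⟨ξ, -, h⟩ := hstep k (hsub k hk)
    rw [h, inner_smul_self_of_norm_eq_one hun]
  have hx1 : ∀ k ∈ Finset.Ico (N + 1) t, |inner ℝ E.dir (x k)| ≤ 1 := by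
    intro k hk
    obtain ⟨ξ, hξ, h⟩ := hstep k (hsub k hk)
    have h2 := hE.norm_le _ hξ.1.1
    rw [norm_smul, hun, mul_one, Real.norm_eq_abs] at h2
    rwa [h, inner_smul_self_of_norm_eq_one hun]
  have hv := design1_div_le hP ht'.1 (by omega : t ≤ T) hx1
  obtain ⟨ξ, hξ, hxt⟩ := hstep t ht
  rw [hxt, inner_smul_self_of_norm_eq_one hun]
  refine le_of_isGreatest_pess1 hP hE hE.norm_xstar_pos hE.xstar_eq (hP.γ_nonneg T) ?_ hξ
  have hl0 := hP.log_arg_pos hT1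
  -- The scalar tail bound carries `2 log (1 / δ)` where the algorithm's radius has a single
  -- logarithm, so the valid radius is larger by the factor `√2` in its noise part. Adding the
  -- algorithm's own radius gives `γ`.
  have hlog : Real.log (design1 P.lam x E.dir N t / P.lam) + 2 * Real.log (1 / P.δ)
      ≤ 2 * Real.log ((1 + ((T : ℝ) - 1) / P.lam) / (P.δ / 2)) := by
    have h1 := Real.log_le_log (div_pos (design1_pos hlam x E.dir N t) hlam) hv
    have h2 : Real.log (1 / P.δ) ≤ Real.log (2 / P.δ) := by
      refine Real.log_le_log (by positivity) ?_
      gcongr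
      norm_num
    have h3 := Real.log_nonneg (hP.one_le_arg hT1)
    rw [hP.log_arg_eq hT1]
    linarith
  have hmono : P.β 1 ((t : ℝ) - N) ≤ P.β 1 T := by
    refine hP.β_mono 1 ?_ ?_
    · rw [le_sub_iff_add_le]
      exact_mod_cast (by omega : 1 + N ≤ t)
    · have h1 : (t : ℝ) ≤ T := by exact_mod_cast (by omega : t ≤ T)
      linarith [Nat.cast_nonneg (α := ℝ) N]
  rw [P.β_one_eq T] at hmono
  unfold Params.γ
  set l := Real.log ((1 + ((T : ℝ) - 1) / P.lam) / (P.δ / 2))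
  have hq2 : (∑ k ∈ Finset.Ico (N + 1) t, η k * inner ℝ E.dir (x k)) ^ 2
      / design1 P.lam x E.dir N t ≤ (√2 * (P.ρ * √l)) ^ 2 := by
    refine hq.trans ?_
    rw [mul_pow, mul_pow, Real.sq_sqrt (by norm_num), Real.sq_sqrt hl0.le, mul_left_comm]
    exact mul_le_mul_of_nonneg_left hlog (sq_nonneg _)
  have hest := estimate1_le (P := P) hlam (by positivity) hS.le hφ hx hq2
  have hr : 0 < √(design1 P.lam x E.dir N t) :=
    Real.sqrt_pos.2 (design1_pos hlam x E.dir N t)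
  have h := add_le_add hest (div_le_div_of_nonneg_right hmono hr.le)
  refine h.trans (le_of_eq ?_)
  ring

lemma Env.Valid.six_le_log (hE : E.Valid P) (hP : P.Valid) (hgap : 0 < E.gap P.b) (hd : 1 ≤ d)
    (hT : 1 ≤ T) (hB : E.Bbar P T ≤ T) : 6 ≤ Real.log (1 + T / (P.lam * d)) := by
  have hlam := hP.lam_pos
  have hd' : (1 : ℝ) ≤ d := by exact_mod_cast hd
  have hT' : (1 : ℝ) ≤ T := by exact_mod_cast hT
  refine SafeBandit.six_le_log (by positivity) ?_
  rw [le_div_iff₀ (by positivity)]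
  refine le_trans (le_of_eq ?_) ((hE.mul_log_le_Bbar hP hgap T).trans hB)
  ring

/-- The gap is at most the optimal reward, hence at most `S * ‖x*‖`. An optimal action of small norm
thus forces a small gap, a large threshold, and so a large `T`. -/
lemma Env.Valid.lam_le (hE : E.Valid P) (hP : P.Valid) (hgap : 0 < E.gap P.b) (hd : 1 ≤ d)
    (hT : 1 ≤ T) (hB : E.Bbar P T ≤ T) : P.lam ≤ T * ‖E.xstar‖ ^ 2 := by
  have hlam := hP.lam_pos
  have hd' : (1 : ℝ) ≤ d := by exact_mod_cast hd
  have hL := hE.six_le_log hP hgap hd hT hB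
  have h2 : E.gap P.b ≤ P.S * ‖E.xstar‖ := by
    refine (hE.gap_le_reward hP).trans ((real_inner_le_norm _ _).trans ?_)
    gcongr
    exact hE.norm_θ_le.trans (le_max_right _ _)
  have h3 : P.lam * (P.S / E.gap P.b) ^ 2 ≤ T := by
    refine le_trans ?_ ((Env.le_Bbar hP hgap T).trans hB)
    refine mul_le_mul_of_nonneg_right ?_ (sq_nonneg _)
    have : 1 ≤ 72 * d * Real.log (1 + T / (P.lam * d)) := by nlinarith
    nlinarith
  have h4 : 1 ≤ P.S / E.gap P.b * ‖E.xstar‖ := by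
    rw [div_mul_eq_mul_div]
    exact (one_le_div hgap).2 h2
  calc P.lam ≤ P.lam * (P.S / E.gap P.b * ‖E.xstar‖) ^ 2 :=
        le_mul_of_one_le_right hlam.le (one_le_pow₀ h4)
    _ = P.lam * (P.S / E.gap P.b) ^ 2 * ‖E.xstar‖ ^ 2 := by ring
    _ ≤ _ := by gcongr

lemma sum_regret_second_phase_le (hP : P.Valid) (hE : E.Valid P) (hd : 2 ≤ d)
    (hgap : 0 < E.gap P.b) (hNT : N < T) (hB : E.Bbar P T ≤ T)
    (hstep : ∀ t ∈ Finset.Ico (N + 1) (T + 1), ∃ ξ,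
      IsGreatest (pess1 P E.X x (fun k => inner ℝ E.a (x k) + η k) E.dir N t) ξ ∧
        x t = ξ • E.dir)
    (hq : ∀ t ∈ Finset.Ico (N + 1) (T + 1),
      (∑ k ∈ Finset.Ico (N + 1) t, η k * inner ℝ E.dir (x k)) ^ 2 / design1 P.lam x E.dir N t
        ≤ P.ρ ^ 2 * (Real.log (design1 P.lam x E.dir N t / P.lam) + 2 * Real.log (1 / P.δ))) :
    ∑ t ∈ Finset.Ico (N + 1) (T + 1), inner ℝ E.θ (E.xstar - x t)
      ≤ 2 * (1 + P.S / P.b) * P.β 1 T * √(2 * T * Real.log (1 + T / (P.lam * d))) := by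
  have hlam := hP.lam_pos
  have hb := hP.b_pos
  have hc0 := hE.norm_xstar_pos
  have hγ0 := hP.γ_nonneg T
  have hd1 : 1 ≤ d := by omega
  have hT : 1 ≤ T := by omega
  have hξ := fun t ht => second_phase_self_bound hP hE (T := T) (t := t) ht hstep (hq t ht)
  have hL6 := hE.six_le_log hP hgap hd1 hT hB
  have hsum := sum_one_sub_div_le hP.lam_ge hb hc0 (hE.norm_le _ hE.xstar_mem.1) hγ0
    (n := N) (ξ := fun t => inner ℝ E.dir (x t)) hNT.le (hE.lam_le hP hgap hd1 hT hB)
    (fun t ht => (hξ t ht).1) (fun t ht => (hξ t ht).2)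
  refine le_trans ?_ (second_phase_numeric hP.S_pos hb hγ0 (hP.γ_le_β_one T) (hP.γ_le_β hd T)
    (hP.β_pos d T).le (hP.β_pos 1 T).le hgap (hE.gap_le_S hP) (Nat.cast_nonneg T) hL6
    (log_add_one_le hd (Nat.cast_nonneg T) hlam hL6) hB)
  -- Along the optimal direction the loss of a round is the optimal reward times the relative
  -- shortfall of the scalar.
  have hterm : ∀ t ∈ Finset.Ico (N + 1) (T + 1), inner ℝ E.θ (E.xstar - x t)
      = inner ℝ E.θ E.xstar * (1 - inner ℝ E.dir (x t) / ‖E.xstar‖) := by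
    intro t ht
    obtain ⟨ξ, -, hxt⟩ := hstep t ht
    have h : x t = (ξ / ‖E.xstar‖) • E.xstar := by
      rw [hxt, Env.dir, smul_smul, div_eq_mul_inv]
    rw [hxt, inner_smul_self_of_norm_eq_one hE.norm_dir, ← hxt, h, inner_sub_right,
      inner_smul_right]
    ring
  have hlogT : 0 ≤ Real.log (1 + T / P.lam) :=
    Real.log_nonneg (le_add_of_nonneg_right (by positivity))
  have h0 : 0 ≤ 2 * P.γ T / P.b * √T
      + P.γ T ^ 2 / P.b ^ 2 * (Real.log (1 + T / P.lam) + 1) := by positivity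
  have h1 : inner ℝ E.θ E.xstar ≤ P.S := hE.reward_le.trans (le_max_right _ _)
  rw [Finset.sum_congr rfl hterm, ← Finset.mul_sum]
  exact (mul_le_mul_of_nonneg_left hsum hE.reward_pos.le).trans (mul_le_mul_of_nonneg_right h1 h0)

open Classical in
/-- The coordinate of the action along `u`, once `u` has been played more than `B` times. -/
def phaseWeight (B : ℝ) (x : ℕ → Vec d) (u : Vec d) (t : ℕ) : ℝ :=
  if B < dirCount x u (t - 1) then inner ℝ u (x t) else 0

/-- The weights vanish up to the random switching round and are the coordinates afterwards. A sum
over all past rounds, to which the tail bound applies, thus becomes the reinitialized sum of the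
algorithm. -/
lemma sum_phaseWeight {B : ℝ} {u : Vec d} {n t : ℕ} (hn : Switch B x n u) (ht : n + 1 ≤ t)
    {f : ℕ → ℝ → ℝ} (hf : ∀ k, f k 0 = 0) :
    ∑ k ∈ Finset.Ico 1 t, f k (phaseWeight B x u k)
      = ∑ k ∈ Finset.Ico (n + 1) t, f k (inner ℝ u (x k)) := by
  rw [← Finset.sum_Ico_consecutive _ (by omega : 1 ≤ n + 1) ht,
    Finset.sum_eq_zero (s := Finset.Ico 1 (n + 1)), zero_add]
  · refine Finset.sum_congr rfl fun k hk => ?_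
    rw [Finset.mem_Ico] at hk
    rw [phaseWeight, if_pos]
    refine hn.2.1.trans_le ?_
    exact_mod_cast dirCount_mono x u (by omega : n ≤ k - 1)
  · intro k hk
    rw [Finset.mem_Ico] at hk
    rw [phaseWeight, if_neg, hf]
    exact not_lt.2 (hn.2.2 (k - 1) (by omega) u hn.1)

/-- The regret of PD-OPLB on the confidence event, split into the two phases. -/
lemma exists_regret_split (hP : P.Valid) (hE : E.Valid P) (hd : 2 ≤ d)
    (hgap : 0 < E.gap P.b) (hT : 1 ≤ T)
    (hstep : ∀ t ∈ Finset.Icc 1 T, PDOPLBStep P E.X (E.Bbar P T) x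
      (fun k => inner ℝ E.θ (x k) + ε k) (fun k => inner ℝ E.a (x k) + η k) t)
    (hθ : ∀ t ∈ Finset.Icc 1 T, Confident P x E.θ ε t)
    (ha : ∀ t ∈ Finset.Icc 1 T, Confident P x E.a η t)
    (hq : ∀ t, 1 ≤ t → t ≤ T + 1 →
      (∑ k ∈ Finset.Ico 1 t, η k * phaseWeight (E.Bbar P T) x E.dir k) ^ 2
          / (P.lam + ∑ k ∈ Finset.Ico 1 t, phaseWeight (E.Bbar P T) x E.dir k ^ 2)
        ≤ P.ρ ^ 2 * (Real.log ((P.lam + ∑ k ∈ Finset.Ico 1 t,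
          phaseWeight (E.Bbar P T) x E.dir k ^ 2) / P.lam) + 2 * Real.log (1 / P.δ))) :
    ∃ r₁ r₂ : ℝ, E.regret x T = r₁ + r₂ ∧
      r₁ ≤ 4 * (1 + P.S / P.b) * P.β d (2 * E.Bbar P T)
        * √(d * E.Bbar P T * Real.log (1 + 2 * E.Bbar P T / (P.lam * d))) ∧
      r₁ ≤ 12 * (1 + P.S / P.b) * (1 + 2 * P.S / P.b) * d * P.β d T ^ 2
        * Real.log (1 + T / (P.lam * d)) / E.gap P.b ∧
      r₂ ≤ 2 * (1 + P.S / P.b) * P.β 1 T * √(2 * T * Real.log (1 + T / (P.lam * d))) := by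
  obtain ⟨N, hNT, hopt, hdir, hN⟩ := PDOPLBStep.exists_phases hstep
  have hsub : ∀ t ∈ Finset.Icc 1 N, t ∈ Finset.Icc 1 T := fun t ht =>
    Finset.Icc_subset_Icc_right hNT ht
  have hgood : GoodOPLB P E x ε η N :=
    ⟨hopt, fun t ht => hθ t (hsub t ht), fun t ht => ha t (hsub t ht)⟩
  have hd1 : 1 ≤ d := by omega
  have hlen := hgood.length_le hP hE hd1 hgap hNT hT hdir
  refine ⟨E.regret x N, ∑ t ∈ Finset.Ico (N + 1) (T + 1), inner ℝ E.θ (E.xstar - x t), ?_,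
    hgood.regret_le_Bbar hP hE hd1 hlen, hgood.regret_le_gap hP hE hd1 hgap hNT hlen, ?_⟩
  · unfold Env.regret
    rw [← Finset.Ico_add_one_right_eq_Icc, ← Finset.Ico_add_one_right_eq_Icc,
      Finset.sum_Ico_consecutive _ (by omega) (by omega)]
  · rcases hN with rfl | ⟨hlt, u, hu⟩
    · rw [Finset.Ico_self, Finset.sum_empty]
      have := hP.one_le_S_div
      have := hP.β_pos 1 N
      positivity
    · obtain rfl := hgood.eq_dir_of_switch hP hE hd1 hgap hNT hu
      refine sum_regret_second_phase_le hP hE hd hgap hlt ?_ (η := η) ?_ ?_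
      -- The threshold is at most `T` because a direction was played more often than the threshold
      -- within `N ≤ T` rounds.
      · refine hu.2.1.le.trans ?_
        have h1 : dirCount x E.dir N ≤ N := by
          rw [dirCount_congr hE.sameDir_dir]
          have := dirCount_add_wrongCount (E := E) x N
          omega
        exact_mod_cast h1.trans hNT
      · intro t ht
        rw [Finset.mem_Ico] at ht
        exact (hstep t (Finset.mem_Icc.2 ⟨by omega, by omega⟩)).2 N (by omega) _ hu
      · intro t ht
        rw [Finset.mem_Ico] at ht
        have h := hq t (by omega) (by omega)
        rw [sum_phaseWeight hu ht.1 (f := fun k w => η k * w) (by simp),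
          sum_phaseWeight hu ht.1 (f := fun _ w => w ^ 2) (by simp)] at h
        exact h

end SecondPhaseRegret

/-! ### The bound up to powers of `log (2 + T)` -/

section PolylogBound

variable {d : ℕ} {P : Params} {T : ℕ}

lemma Params.Valid.β_le (hP : P.Valid) (hd : 1 ≤ d) (hT : 1 ≤ T) :
    P.β d T ≤ (P.ρ * √(1 + Real.log (2 / P.δ)) + √P.lam * P.S)
      * √(d * Real.log (2 + T)) := by
  have hd' : (1 : ℝ) ≤ d := by exact_mod_cast hd
  have hT' : (1 : ℝ) ≤ T := by exact_mod_cast hT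
  have hδ := hP.log_two_div_pos
  have hlam := hP.lam_ge
  have hS := hP.S_pos
  have hl : 1 ≤ Real.log (2 + T) := by
    rw [Real.le_log_iff_exp_le (by linarith)]
    linarith [Real.exp_one_lt_d9]
  have harg : Real.log ((1 + ((T : ℝ) - 1) / P.lam) / (P.δ / 2))
      ≤ (1 + Real.log (2 / P.δ)) * Real.log (2 + T) := by
    rw [hP.log_arg_eq hT']
    have h1 : Real.log (1 + ((T : ℝ) - 1) / P.lam) ≤ Real.log (2 + T) := by
      refine Real.log_le_log (by linarith [hP.one_le_arg hT']) ?_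
      have := div_le_self (by linarith : (0 : ℝ) ≤ T - 1) hlam
      linarith
    nlinarith
  have h1 : √(d * Real.log ((1 + ((T : ℝ) - 1) / P.lam) / (P.δ / 2)))
      ≤ √(1 + Real.log (2 / P.δ)) * √(d * Real.log (2 + T)) := by
    rw [← Real.sqrt_mul (by positivity)]
    refine Real.sqrt_le_sqrt ?_
    calc _ ≤ d * ((1 + Real.log (2 / P.δ)) * Real.log (2 + T)) := by gcongr
      _ = _ := by ring
  have h2 : 1 ≤ √(d * Real.log (2 + T)) := Real.one_le_sqrt.2 (by nlinarith)
  rw [Params.β, add_mul, mul_assoc P.ρ]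
  exact add_le_add (mul_le_mul_of_nonneg_left h1 hP.ρ_nonneg)
    (le_mul_of_one_le_right (by positivity) h2)

lemma polylog_bound (hP : P.Valid) (hd : 1 ≤ d) (hT : 1 ≤ T) {Δ : ℝ} (hΔ : 0 < Δ) {K : ℝ}
    (hK : K = P.ρ * √(1 + Real.log (2 / P.δ)) + √P.lam * P.S) :
    12 * (1 + P.S / P.b) * (1 + 2 * P.S / P.b) * d * P.β d T ^ 2
        * Real.log (1 + T / (P.lam * d)) / Δ
      + 2 * (1 + P.S / P.b) * P.β 1 T * √(2 * T * Real.log (1 + T / (P.lam * d)))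
      ≤ (12 * (1 + P.S / P.b) * (1 + 2 * P.S / P.b) * K ^ 2 + 3 * (1 + P.S / P.b) * K)
        * ((d : ℝ) ^ 2 / Δ + √T) * Real.log (2 + T) ^ 2 := by
  have hd' : (1 : ℝ) ≤ d := by exact_mod_cast hd
  have hT' : (1 : ℝ) ≤ T := by exact_mod_cast hT
  have hδ := hP.log_two_div_pos
  have hlam := hP.lam_pos
  have hS := hP.S_pos
  have hb := hP.b_pos
  have hρ := hP.ρ_nonneg
  have hK0 : 0 ≤ K := by
    rw [hK]
    positivity
  have hβd := hP.β_le hd hT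
  have hβ1 := hP.β_le (d := 1) le_rfl hT
  rw [← hK] at hβd hβ1
  rw [Nat.cast_one, one_mul] at hβ1
  set ℓ := Real.log (2 + T) with hℓ
  have hl : 1 ≤ ℓ := by
    rw [hℓ, Real.le_log_iff_exp_le (by linarith)]
    linarith [Real.exp_one_lt_d9]
  have hl0 : 0 ≤ ℓ := by linarith
  have hL0 := log_one_add_nonneg hP (Nat.cast_nonneg T) d
  have hLℓ : Real.log (1 + T / (P.lam * d)) ≤ ℓ := by
    refine Real.log_le_log (by positivity) ?_
    have : (T : ℝ) / (P.lam * d) ≤ T :=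
      div_le_self (by positivity) (by nlinarith [hP.lam_ge])
    linarith
  set L := Real.log (1 + T / (P.lam * d)) with hLdef
  set s := P.S / P.b with hs
  have hs0 : 0 < s := by positivity
  have hs2 : 2 * P.S / P.b = 2 * s := by rw [hs]; ring
  rw [hs2]
  have hβd0 := (hP.β_pos d T).le
  have hβ2 : P.β d T ^ 2 ≤ K ^ 2 * (d * ℓ) := by
    have h := pow_le_pow_left₀ hβd0 hβd 2
    rwa [mul_pow, Real.sq_sqrt (by positivity)] at h
  have hA : 12 * (1 + s) * (1 + 2 * s) * d * P.β d T ^ 2 * L / Δ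
      ≤ 12 * (1 + s) * (1 + 2 * s) * K ^ 2 * ((d : ℝ) ^ 2 / Δ) * ℓ ^ 2 := by
    calc _ ≤ 12 * (1 + s) * (1 + 2 * s) * d * (K ^ 2 * (d * ℓ)) * ℓ / Δ := by gcongr
      _ = _ := by ring
  have hsq : √(2 * T * L) ≤ 1.5 * √T * √ℓ := by
    calc √(2 * T * L) ≤ √(2 * T * ℓ) := by gcongr
      _ = √2 * √T * √ℓ := by rw [Real.sqrt_mul (by positivity), Real.sqrt_mul (by norm_num)]
      _ ≤ _ := by
        have : √2 ≤ (1.5 : ℝ) := Real.sqrt_le_iff.2 (by norm_num)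
        gcongr
  have hB : 2 * (1 + s) * P.β 1 T * √(2 * T * L) ≤ 3 * (1 + s) * K * √T * ℓ ^ 2 := by
    calc _ ≤ 2 * (1 + s) * (K * √ℓ) * (1.5 * √T * √ℓ) := by
          have := (hP.β_pos 1 T).le
          gcongr
      _ = 3 * (1 + s) * K * √T * (√ℓ * √ℓ) := by ring
      _ = 3 * (1 + s) * K * √T * ℓ := by rw [Real.mul_self_sqrt hl0]
      _ ≤ _ := by
          refine mul_le_mul_of_nonneg_left ?_ (by positivity)
          nlinarith
  have hC1 : 0 ≤ 12 * (1 + s) * (1 + 2 * s) * K ^ 2 * √T * ℓ ^ 2 := by positivity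
  have hC2 : 0 ≤ 3 * (1 + s) * K * ((d : ℝ) ^ 2 / Δ) * ℓ ^ 2 := by positivity
  calc _ ≤ 12 * (1 + s) * (1 + 2 * s) * K ^ 2 * ((d : ℝ) ^ 2 / Δ) * ℓ ^ 2
        + 3 * (1 + s) * K * √T * ℓ ^ 2 := add_le_add hA hB
    _ ≤ _ := by
        have : (12 * (1 + s) * (1 + 2 * s) * K ^ 2 + 3 * (1 + s) * K) * ((d : ℝ) ^ 2 / Δ + √T)
            * ℓ ^ 2 = 12 * (1 + s) * (1 + 2 * s) * K ^ 2 * ((d : ℝ) ^ 2 / Δ) * ℓ ^ 2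
              + 3 * (1 + s) * K * √T * ℓ ^ 2
              + (12 * (1 + s) * (1 + 2 * s) * K ^ 2 * √T * ℓ ^ 2
              + 3 * (1 + s) * K * ((d : ℝ) ^ 2 / Δ) * ℓ ^ 2) := by ring
        linarith

end PolylogBound

/-! ### Probability of the confidence event and the theorem -/

section Main

variable {d T : ℕ} {P : Params} {E : Env d} {Ω : Type*} [MeasurableSpace Ω] {μ : Measure Ω}
  [IsProbabilityMeasure μ] {R : Run d Ω}

/-- Subadditivity holds for all sets, so neither the success event nor the failure event has to be
measurable. -/
lemma one_sub_le_measureReal {G A : Set Ω} {p : ℝ} (hp : 0 ≤ p) (hA : μ A ≤ ENNReal.ofReal p)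
    (h : ∀ᵐ ω ∂μ, ω ∉ A → ω ∈ G) : 1 - p ≤ μ.real G := by
  have h1 : (1 : ENNReal) ≤ μ (G ∪ A) := by
    rw [← measure_univ (μ := μ)]
    refine measure_mono_ae ?_
    filter_upwards [h] with ω hω _
    by_cases hA : ω ∈ A
    · exact Or.inr hA
    · exact Or.inl (hω hA)
  have h2 : (1 : ENNReal) ≤ ENNReal.ofReal (μ.real G + p) := by
    rw [ENNReal.ofReal_add measureReal_nonneg hp, ofReal_measureReal]
    exact h1.trans ((measure_union_le _ _).trans (add_le_add le_rfl hA))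
  have h3 := ENNReal.one_le_ofReal.1 h2
  linarith

/-- The outcomes for which some confidence set for the parameter is not valid, for noise `e`. -/
def failureSet (P : Params) (x : ℕ → Ω → Vec d) (e : ℕ → Ω → ℝ) (T : ℕ) : Set Ω :=
  {ω | ∃ t, 1 ≤ t ∧ t ≤ T + 1 ∧
    P.ρ ^ 2 * (Real.log (detRatio P.lam (x · ω) t) + 2 * Real.log (1 / (P.δ / 2)))
      < (noiseSum (x · ω) (e · ω) t).ofLp ⬝ᵥ (design P.lam (x · ω) t)⁻¹ *ᵥ
        (noiseSum (x · ω) (e · ω) t).ofLp}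

lemma Run.Valid.measure_failureSet_union_le (hP : P.Valid) (hR : R.Valid μ P.ρ T) :
    μ (failureSet P R.x R.ε T ∪ failureSet P R.x R.η T) ≤ ENNReal.ofReal P.δ := by
  have hδ : 0 < P.δ / 2 := half_pos hP.δ_pos
  refine (measure_union_le _ _).trans ((add_le_add
    (measure_exists_lt_noiseSum_le hR.meas_x hR.meas_ε hP.ρ_nonneg hP.lam_pos hδ hR.noise_ε)
    (measure_exists_lt_noiseSum_le hR.meas_x hR.meas_η hP.ρ_nonneg hP.lam_pos hδ hR.noise_η)).trans
    (le_of_eq ?_))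
  rw [← ENNReal.ofReal_add hδ.le hδ.le, add_halves]

omit [MeasurableSpace Ω] in
lemma confident_of_notMem_failureSet (hP : P.Valid) (hd : 2 ≤ d) {x : ℕ → Ω → Vec d}
    {e : ℕ → Ω → ℝ} {ω : Ω} (hω : ω ∉ failureSet P x e T) {θ : Vec d} (hθ : ‖θ‖ ≤ P.S)
    (hx : ∀ t ∈ Finset.Icc 1 T, ‖x t ω‖ ≤ 1) {t : ℕ} (ht : t ∈ Finset.Icc 1 T) :
    Confident P (x · ω) θ (e · ω) t := by
  rw [Finset.mem_Icc] at ht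
  refine confident_of_quadratic_le hP hd ht.1 hθ (fun k hk => hx k ?_) ?_
  · rw [Finset.mem_Ico] at hk
    exact Finset.mem_Icc.2 ⟨hk.1, by omega⟩
  · by_contra! h
    exact hω ⟨t, ht.1, by omega, h⟩

/-- The outcomes for which the one-dimensional confidence set along `u` is not valid. -/
def scalarFailureSet (P : Params) (B : ℝ) (x : ℕ → Ω → Vec d) (e : ℕ → Ω → ℝ) (u : Vec d)
    (T : ℕ) : Set Ω :=
  {ω | ∃ t, 1 ≤ t ∧ t ≤ T + 1 ∧
    P.ρ ^ 2 * (Real.log ((P.lam + ∑ k ∈ Finset.Ico 1 t, phaseWeight B (x · ω) u k ^ 2) / P.lam)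
        + 2 * Real.log (1 / P.δ))
      < (∑ k ∈ Finset.Ico 1 t, e k ω * phaseWeight B (x · ω) u k) ^ 2
        / (P.lam + ∑ k ∈ Finset.Ico 1 t, phaseWeight B (x · ω) u k ^ 2)}

-- The weight of round `t` depends on the plays before `t` and on the action of round `t`, all of
-- which belong to the history. The vector `u` must be deterministic here.
omit [MeasurableSpace Ω] in
lemma measurable_phaseWeight {u : Vec d} (hu : ‖u‖ = 1) (B : ℝ) (x : ℕ → Ω → Vec d)
    (e : ℕ → Ω → ℝ) {t : ℕ} (ht : 1 ≤ t) :
    Measurable[history x e t] fun ω => phaseWeight B (x · ω) u t := by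
  classical
  have hcount : Measurable[history x e t] fun ω => (dirCount (x · ω) u (t - 1) : ℝ) := by
    have : (fun ω => (dirCount (x · ω) u (t - 1) : ℝ))
        = fun ω => ∑ k ∈ Finset.Icc 1 (t - 1), if SameDir (x k ω) u then (1 : ℝ) else 0 := by
      funext ω
      rw [dirCount, Finset.card_filter]
      push_cast
      refine Finset.sum_congr rfl fun k _ => ?_
      congr
    rw [this]
    refine Finset.measurable_fun_sum _ fun k hk => ?_
    rw [Finset.mem_Icc] at hk
    refine Measurable.ite ?_ measurable_const measurable_const
    exact measurable_action_history x e hk.1 (by omega) (measurableSet_sameDir hu)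
  unfold phaseWeight
  refine Measurable.ite (measurableSet_lt measurable_const hcount) ?_ measurable_const
  exact (continuous_const.inner continuous_id).measurable.comp
    (measurable_action_history x e ht le_rfl)

theorem Run.Valid.wrongCount_bound (hP : P.Valid) (hd : 2 ≤ d) (hE : E.Valid P)
    (hgap : 0 < E.gap P.b) (hR : R.Valid μ P.ρ T) (h : R.IsOPLB μ P E T) :
    1 - P.δ ≤ μ.real {ω | (E.wrongCount (R.act ω) T : ℝ) ≤
      8 * d * (1 + 2 * P.S / P.b) ^ 2 * P.β d T ^ 2 * Real.log (1 + T / (P.lam * d))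
        / E.gap P.b ^ 2} := by
  refine one_sub_le_measureReal hP.δ_pos.le (hR.measure_failureSet_union_le hP) ?_
  filter_upwards [h] with ω hω hnot
  rw [Set.mem_union, not_or] at hnot
  have hx : ∀ t ∈ Finset.Icc 1 T, ‖R.x t ω‖ ≤ 1 := fun t ht => hE.norm_le _ (hω t ht).1.1
  have hgood : GoodOPLB P E (R.x · ω) (R.ε · ω) (R.η · ω) T :=
    ⟨hω, fun t ht => confident_of_notMem_failureSet hP hd hnot.1
        (hE.norm_θ_le.trans (le_max_right _ _)) hx ht,
      fun t ht => confident_of_notMem_failureSet hP hd hnot.2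
        (hE.norm_a_le.trans (le_max_left _ _)) hx ht⟩
  have h1 := hgood.wrongCount_le_Bbar hP hE (by omega) hgap le_rfl
  have h2 := hE.Bbar_nonneg hP hgap T
  change (E.wrongCount (R.x · ω) T : ℝ) ≤ E.Bbar P T
  linarith

theorem Run.Valid.regret_bound (hP : P.Valid) (hd : 2 ≤ d) (hE : E.Valid P)
    (hgap : 0 < E.gap P.b) (hR : R.Valid μ P.ρ T) (h : R.IsPDOPLB μ P E T) {K : ℝ}
    (hK : K = P.ρ * √(1 + Real.log (2 / P.δ)) + √P.lam * P.S) :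
    1 - 2 * P.δ ≤ μ.real {ω |
      E.regret (R.act ω) T ≤
        4 * (1 + P.S / P.b) * P.β d (2 * E.Bbar P T)
            * √(d * E.Bbar P T * Real.log (1 + 2 * E.Bbar P T / (P.lam * d)))
          + 2 * (1 + P.S / P.b) * P.β 1 T * √(2 * T * Real.log (1 + T / (P.lam * d))) ∧
      E.regret (R.act ω) T ≤
        (12 * (1 + P.S / P.b) * (1 + 2 * P.S / P.b) * K ^ 2 + 3 * (1 + P.S / P.b) * K)
          * ((d : ℝ) ^ 2 / E.gap P.b + √T) * Real.log (2 + T) ^ 2} := by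
  have hδ := hP.δ_pos
  have hA : μ ((failureSet P R.x R.ε T ∪ failureSet P R.x R.η T)
      ∪ scalarFailureSet P (E.Bbar P T) R.x R.η E.dir T) ≤ ENNReal.ofReal (2 * P.δ) := by
    rw [two_mul, ENNReal.ofReal_add hδ.le hδ.le]
    refine (measure_union_le _ _).trans (add_le_add (hR.measure_failureSet_union_le hP) ?_)
    exact measure_exists_lt_weighted_le hR.meas_x hR.meas_η hP.ρ_nonneg hP.lam_pos hδ hR.noise_η
      fun t ht => measurable_phaseWeight hE.norm_dir _ R.x R.η ht
  refine one_sub_le_measureReal (by linarith) hA ?_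
  filter_upwards [h] with ω hω hnot
  rw [Set.mem_union, Set.mem_union, not_or, not_or] at hnot
  have hs := hP.one_le_S_div
  have hs2 : 0 ≤ 1 + 2 * P.S / P.b := by
    rw [mul_div_assoc]
    linarith
  have hK0 : 0 ≤ K := by
    have := hP.log_two_div_pos
    have := hP.ρ_nonneg
    have := hP.S_pos
    rw [hK]
    positivity
  -- The empty horizon is separate because the absolute lower bound on the threshold needs `T ≥ 1`.
  rcases Nat.eq_zero_or_pos T with rfl | hT
  · have h0 : E.regret (R.act ω) 0 = 0 := by simp [Env.regret]
    have h1 := hP.β_pos d (2 * E.Bbar P 0)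
    have h2 := hP.β_pos 1 (0 : ℕ)
    have h3 : 0 ≤ Real.log (2 + (0 : ℕ)) := Real.log_nonneg (by norm_num)
    change _ ∧ _
    rw [h0]
    constructor <;> positivity
  have hx : ∀ t ∈ Finset.Icc 1 T, ‖R.x t ω‖ ≤ 1 := fun t ht => hE.norm_le _ (hω t ht).mem
  obtain ⟨r₁, r₂, hr, h1, h2, h3⟩ := exists_regret_split (x := (R.x · ω)) (ε := (R.ε · ω))
    (η := (R.η · ω)) hP hE hd hgap hT hω
    (fun t ht => confident_of_notMem_failureSet hP hd hnot.1.1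
      (hE.norm_θ_le.trans (le_max_right _ _)) hx ht)
    (fun t ht => confident_of_notMem_failureSet hP hd hnot.1.2
      (hE.norm_a_le.trans (le_max_left _ _)) hx ht)
    (fun t ht1 ht2 => by
      by_contra! hlt
      exact hnot.2 ⟨t, ht1, ht2, hlt⟩)
  have h4 := polylog_bound hP (by omega : 1 ≤ d) hT hgap hK
  have hr' : E.regret (R.act ω) T = r₁ + r₂ := hr
  change _ ∧ _
  rw [hr']
  exact ⟨add_le_add h1 h3, (add_le_add h2 h3).trans h4⟩

end Main

end SafeBandit

end

theorem mainTheorem10 (P : SafeBandit.Params) (hP : P.Valid) :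
    ∃ (C : ℝ) (k : ℕ), ∀ (d T : ℕ), 2 ≤ d →
      ∀ (E : SafeBandit.Env d), E.Valid P → 0 < E.gap P.b →
      ∀ (Ω : Type*) [MeasurableSpace Ω] (μ : Measure Ω) [IsProbabilityMeasure μ]
        (R : SafeBandit.Run d Ω), R.Valid μ P.ρ T →
        (R.IsOPLB μ P E T →
          1 - P.δ ≤ μ.real {ω | (E.wrongCount (R.act ω) T : ℝ) ≤
            8 * d * (1 + 2 * P.S / P.b) ^ 2 * P.β d T ^ 2 * Real.log (1 + T / (P.lam * d))
              / E.gap P.b ^ 2}) ∧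
        (R.IsPDOPLB μ P E T →
          1 - 2 * P.δ ≤ μ.real {ω |
            E.regret (R.act ω) T ≤
              4 * (1 + P.S / P.b) * P.β d (2 * E.Bbar P T)
                  * √(d * E.Bbar P T * Real.log (1 + 2 * E.Bbar P T / (P.lam * d)))
                + 2 * (1 + P.S / P.b) * P.β 1 T * √(2 * T * Real.log (1 + T / (P.lam * d))) ∧
            E.regret (R.act ω) T ≤
              C * ((d : ℝ) ^ 2 / E.gap P.b + √T) * Real.log (2 + T) ^ k}) := by
  refine ⟨12 * (1 + P.S / P.b) * (1 + 2 * P.S / P.b)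
      * (P.ρ * √(1 + Real.log (2 / P.δ)) + √P.lam * P.S) ^ 2
      + 3 * (1 + P.S / P.b) * (P.ρ * √(1 + Real.log (2 / P.δ)) + √P.lam * P.S), 2, ?_⟩
  intro d T hd E hE hgap Ω _ μ _ R hR
  exact ⟨hR.wrongCount_bound hP hd hE hgap, fun h => hR.regret_bound hP hd hE hgap h rfl⟩
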